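/- Let $R$ and $S$ be associative rings with identity. Write $\operatorname{Mod}S$ for the category of left $S$-modules, and $S^{op}$-module for right $S$-module. Let ${}_RC_S$ be a semidualizing $(R,S)$-bimodule, that is: ${}_RC$ and $C_S$ each admit a projective resolution by finitely generated projective modules; the homothety maps $R\to\operatorname{Hom}_{S^{op}}(C,C)$, $r\mapsto(c\mapsto rc)$, and $S\to\operatorname{Hom}_R(C,C)$, $s\mapsto(c\mapsto cs)$, are bijective; and $\operatorname{Ext}_R^{i}(C,C)=0=\operatorname{Ext}_{S^{op}}^{i}(C,C)$ for all $i\ge 1$. The Auslander class $\mathcal A_C(S)$ consists of all $N\in\operatorname{Mod}S$ such that $\operatorname{Tor}^S_i(C,N)=0$ and $\operatorname{Ext}^i_R(C,C\otimes_SN)=0$ for all $i\ge1$ and such that the canonical map $\mu_N:N\to\operatorname{Hom}_R(C,C\otimes_SN)$, $\mu_N(x)(c)=c\otimes x$, is an isomorphism. The Auslander projective dimension $\mathcal A_C(S)\text{-}\operatorname{pd}_SN$ of $N\in\operatorname{Mod}S$ is the infimum of all integers $m\ge0$ for which there is an exact sequence $0\to X_m\to\cdots\to X_1\to X_0\to N\to0$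 in $\operatorname{Mod}S$ with all $X_i\in\mathcal A_C(S)$ (and $\infty$ if there is no such $m$). An $R$-module $X$ has an ultimately closed projective resolution if there are a projective resolution $\cdots\to P_1\xrightarrow{g_1}P_0\xrightarrow{g_0}X\to0$ and an integer $m\ge1$ such that $\operatorname{Im}g_m\cong\bigoplus_jW_j$, where each $W_j$ is isomorphic to a direct summand of some $\operatorname{Im}g_{i_j}$ with $0\le i_j<m$. **Corollary 4.11.** If ${}_RC$ has an ultimately closed projective resolution, then for every integer $n\ge0$ the following statements are equivalent: 1. the projective dimension of the right $S$-module $C_S$ is at most $n$, i.e. $\operatorname{pd}_{S^{op}}C\le n$; 2. $\mathcal A_C(S)\text{-}\operatorname{pd}_SN\le n$ for every $N\in\operatorname{Mod}S$. -/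

import Mathlib

open CategoryTheory
open scoped TensorProduct DirectSum

universe u

namespace SemidualizingBimodule

noncomputable section

/-! An `(R, S)`-bimodule `C` is a left `R`-module `C` that is also a right `S`-module, i.e. a module
over `Sᵐᵒᵖ`, such that the two actions commute.  `Mod S` is `ModuleCat S`, and right `S`-modules are
the objects of `ModuleCat Sᵐᵒᵖ`. -/

section Tensor

variable (R S : Type u) [Ring R] [Ring S] (C : Type u) [AddCommGroup C] [Module R C]
  [Module Sᵐᵒᵖ C]

/-- The relations `(c s) ⊗ x = c ⊗ (s x)` by which `C ⊗[S] N` is a quotient of `C ⊗[ℤ] N`.  When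
the actions of `R` and `S` on `C` commute, the generating set is stable under `R`, so that its
`R`-span is the additive subgroup that it generates. -/
def balancedRelations (N : Type u) [AddCommGroup N] [Module S N] : Submodule R (C ⊗[ℤ] N) :=
  Submodule.span R {t | ∃ (c : C) (s : S) (x : N),
    t = (MulOpposite.op s • c) ⊗ₜ[ℤ] x - c ⊗ₜ[ℤ] (s • x)}

/-- The tensor product `C ⊗[S] N` of an `(R, S)`-bimodule and a left `S`-module, a left `R`-module
through the action of `R` on `C`. -/
abbrev BalancedTensor (N : Type u) [AddCommGroup N] [Module S N] : Type u :=
  (C ⊗[ℤ] N) ⧸ balancedRelations R S C N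

variable {C} in
/-- The class of the pure tensor `c ⊗ x` in `C ⊗[S] N`. -/
def tmul {N : Type u} [AddCommGroup N] [Module S N] (c : C) (x : N) : BalancedTensor R S C N :=
  (balancedRelations R S C N).mkQ (c ⊗ₜ[ℤ] x)

/-- The map `1_C ⊗ f : C ⊗[S] N → C ⊗[S] N'` induced by an `S`-linear map `f : N → N'`. -/
def tensorMap {N N' : Type u} [AddCommGroup N] [Module S N] [AddCommGroup N'] [Module S N']
    (f : N →ₗ[S] N') : BalancedTensor R S C N →ₗ[R] BalancedTensor R S C N' :=
  Submodule.mapQ (balancedRelations R S C N) (balancedRelations R S C N')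
    (TensorProduct.AlgebraTensorModule.map (LinearMap.id : C →ₗ[R] C) (f.restrictScalars ℤ)) (by
      rw [balancedRelations, Submodule.span_le]
      rintro _ ⟨c, s, x, rfl⟩
      refine Submodule.subset_span ⟨c, s, f x, ?_⟩
      simp)

variable {S} in
theorem tensorMap_tmul {N N' : Type u} [AddCommGroup N] [Module S N] [AddCommGroup N']
    [Module S N'] (f : N →ₗ[S] N') (c : C) (x : N) :
    tensorMap R S C f (tmul R S c x) = tmul R S c (f x) := by
  simp [tensorMap, tmul]

variable {R S C} in
/-- Two `R`-linear maps out of `C ⊗[S] N` are equal if they agree on pure tensors. -/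
theorem balancedTensor_hom_ext {N : Type u} [AddCommGroup N] [Module S N] {X : Type u}
    [AddCommGroup X] [Module R X] {f g : BalancedTensor R S C N →ₗ[R] X}
    (h : ∀ c x, f (tmul R S c x) = g (tmul R S c x)) : f = g := by
  apply Submodule.linearMap_qext
  apply TensorProduct.AlgebraTensorModule.ext
  intro c x
  exact h c x

/-- The functor `C ⊗[S] - : Mod S ⥤ Mod R`. -/
def tensorFunctor : ModuleCat.{u} S ⥤ ModuleCat.{u} R where
  obj N := ModuleCat.of R (BalancedTensor R S C N)
  map f := ModuleCat.ofHom (tensorMap R S C f.hom)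
  map_id N := by
    ext1
    apply balancedTensor_hom_ext
    intro c x
    simp [tensorMap_tmul]
  map_comp f g := by
    ext1
    apply balancedTensor_hom_ext
    intro c x
    simp [tensorMap_tmul]

instance : (tensorFunctor R S C).Additive where
  map_add {N N' f g} := by
    ext1
    apply balancedTensor_hom_ext
    intro c x
    change tensorMap R S C (f.hom + g.hom) (tmul R S c x) =
      tensorMap R S C f.hom (tmul R S c x) + tensorMap R S C g.hom (tmul R S c x)
    simp only [tensorMap_tmul]
    simp [tmul, TensorProduct.tmul_add]

/-- `Tor_i^S(C, N)`, the `i`-th left derived functor of `C ⊗[S] -` at `N`, with its left `R`-module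
structure. -/
def bimoduleTor (i : ℕ) (N : ModuleCat.{u} S) : ModuleCat.{u} R :=
  ((tensorFunctor R S C).leftDerived i).obj N

variable [SMulCommClass R Sᵐᵒᵖ C]

/-- The canonical map `μ_N : N → Hom_R(C, C ⊗[S] N)`, `μ_N(x)(c) = c ⊗ x`.  With respect to
the usual left action `(s φ)(c) = φ (c s)` of `S` on `Hom_R(C, C ⊗[S] N)` it is `S`-linear, so it is
an isomorphism in `Mod S` if and only if it is bijective. -/
def valuation (N : Type u) [AddCommGroup N] [Module S N] :
    N →+ (C →ₗ[R] BalancedTensor R S C N) where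
  toFun x :=
    { toFun := fun c => tmul R S c x
      map_add' := fun c c' => by simp [tmul, TensorProduct.add_tmul]
      map_smul' := fun r c => by simp [tmul, ← TensorProduct.smul_tmul'] }
  map_zero' := by ext c; simp [tmul]
  map_add' x y := by ext c; simp [tmul, TensorProduct.tmul_add]

/-- The Auslander class `𝒜_C(S)` in `Mod S`. -/
structure auslanderClass (N : ModuleCat.{u} S) : Prop where
  tor_eq_zero : ∀ i : ℕ, 1 ≤ i → Limits.IsZero (bimoduleTor R S C i N)
  ext_eq_zero : ∀ i : ℕ, 1 ≤ i →
    Subsingleton (Abelian.Ext (ModuleCat.of R C) (ModuleCat.of R (BalancedTensor R S C N)) i)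
  valuation_bijective : Function.Bijective (valuation R S C N)

end Tensor

/-- The module `M` admits a projective resolution by finitely generated projective modules. -/
def HasDegreewiseFiniteResolution {A : Type u} [Ring A] (M : ModuleCat.{u} A) : Prop :=
  ∃ P : ProjectiveResolution M, ∀ i : ℕ, Module.Finite A (P.complex.X i)

/-- The `(R, S)`-bimodule `C` is semidualizing.  The homothety maps are `R → Hom_{Sᵒᵖ}(C, C)`,
`r ↦ (c ↦ r c)`, and `S → Hom_R(C, C)`, `s ↦ (c ↦ c s)`. -/
structure IsSemidualizing (R S : Type u) [Ring R] [Ring S] (C : Type u) [AddCommGroup C]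
    [Module R C] [Module Sᵐᵒᵖ C] [SMulCommClass R Sᵐᵒᵖ C] : Prop where
  finite_left : HasDegreewiseFiniteResolution (ModuleCat.of R C)
  finite_right : HasDegreewiseFiniteResolution (ModuleCat.of Sᵐᵒᵖ C)
  homothety_left : Function.Bijective
    (fun r : R => (Module.toModuleEnd Sᵐᵒᵖ (S := R) C r : C →ₗ[Sᵐᵒᵖ] C))
  homothety_right : haveI := SMulCommClass.symm R Sᵐᵒᵖ C
    Function.Bijective
      (fun s : S => (Module.toModuleEnd R (S := Sᵐᵒᵖ) C (MulOpposite.op s) : C →ₗ[R] C))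
  ext_left : ∀ i : ℕ, 1 ≤ i →
    Subsingleton (Abelian.Ext (ModuleCat.of R C) (ModuleCat.of R C) i)
  ext_right : ∀ i : ℕ, 1 ≤ i →
    Subsingleton (Abelian.Ext (ModuleCat.of Sᵐᵒᵖ C) (ModuleCat.of Sᵐᵒᵖ C) i)

section UltimatelyClosed

variable {A : Type u} [Ring A]

/-- The image of the `k`-th map `g_k` of a projective resolution
`⋯ → P₂ → P₁ → P₀ → X → 0`, where `g₀ : P₀ → X` is the augmentation (which is onto, so that its
image is `X`) and `g_{k+1} : P_{k+1} → P_k`. -/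
def resolutionImage {X : ModuleCat.{u} A} (P : ProjectiveResolution X) : ℕ → ModuleCat.{u} A
  | 0 => X
  | k + 1 => ModuleCat.of A (LinearMap.range (P.complex.d (k + 1) k).hom)

/-- `W` is isomorphic to a direct summand of `M`. -/
def IsDirectSummand (W M : ModuleCat.{u} A) : Prop :=
  ∃ V : ModuleCat.{u} A, Nonempty (M ≃ₗ[A] W × V)

/-- The projective resolution `P` is ultimately closed at `n`: the image of `g_n` is a (possibly
infinite) direct sum of modules each of which is isomorphic to a direct summand of the image of
some `g_i` with `i < n`. -/
def IsUltimatelyClosedAt {X : ModuleCat.{u} A} (P : ProjectiveResolution X) (n : ℕ) : Prop :=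
  ∃ (ι : Type u) (W : ι → ModuleCat.{u} A),
    Nonempty (resolutionImage P n ≃ₗ[A] ⨁ j, W j) ∧
    ∀ j, ∃ i < n, IsDirectSummand (W j) (resolutionImage P i)

/-- `X` has an ultimately closed projective resolution. -/
def HasUltimatelyClosedResolution (X : ModuleCat.{u} A) : Prop :=
  ∃ n : ℕ, 1 ≤ n ∧ ∃ P : ProjectiveResolution X, IsUltimatelyClosedAt P n

end UltimatelyClosed

section RelativeDimension

variable {A : Type u} [Ring A]

/-- There is an exact sequence `0 → X_n → ⋯ → X₁ → X₀ → N → 0` with all `X_i` in the class `𝒳`.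
The sequence is continued to the left by zero modules; exactness at `X_n` then says that the map
leaving `X_n` is injective. -/
def HasResolutionOfLength (𝒳 : ModuleCat.{u} A → Prop) (N : ModuleCat.{u} A) (n : ℕ) : Prop :=
  ∃ (X : ℕ → ModuleCat.{u} A) (d : ∀ i, X (i + 1) →ₗ[A] X i) (ε : X 0 →ₗ[A] N),
    (∀ i ≤ n, 𝒳 (X i)) ∧ (∀ i, n < i → Subsingleton (X i)) ∧
    Function.Surjective ε ∧ Function.Exact (d 0) ε ∧
    ∀ i, Function.Exact (d (i + 1)) (d i)

/-- The `𝒳`-projective dimension of `N`: the least length of a resolution of `N` by modules in `𝒳`,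
and `⊤` if there is none. -/
def relativeProjectiveDimension (𝒳 : ModuleCat.{u} A → Prop) (N : ModuleCat.{u} A) : ℕ∞ :=
  sInf {k : ℕ∞ | ∃ n : ℕ, k = n ∧ HasResolutionOfLength 𝒳 N n}

end RelativeDimension

/-- The Auslander projective dimension of a left `S`-module `N`. -/
def auslanderProjectiveDimension (R S : Type u) [Ring R] [Ring S] (C : Type u) [AddCommGroup C]
    [Module R C] [Module Sᵐᵒᵖ C] [SMulCommClass R Sᵐᵒᵖ C] (N : ModuleCat.{u} S) : ℕ∞ :=
  relativeProjectiveDimension (auslanderClass R S C) N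

end

end SemidualizingBimodule

/-! Write C⁺ = Hom_ℤ(C, ℚ/ℤ). Characters of C ⊗ N are the S-linear maps N → C⁺, and ℚ/ℤ is an
injective cogenerator, so Tor_i(C, N) = 0 iff Ext^i(N, C⁺) = 0 for i ≥ 1 (`isZero_bimoduleTor_iff`).
Since C_S has a degreewise finite projective resolution, pd C ≤ n iff C⁺ has injective dimension at
most n (`forall_subsingleton_ext_characterDual_iff`): shifting dimensions reduces this to the fact
that a finitely presented flat module is projective. Thus the first statement says that Ext^i(N, C⁺)
= 0 for all N and all i > n.

The heart is `IsSemidualizing.auslanderClass_of_ext_characterDual`: under the ultimate closure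
hypothesis, vanishing of Tor alone puts N in the Auslander class. Let Z_j be the syzygies of N.
Projectives lie in the Auslander class and C ⊗ - keeps the syzygy sequences exact, so vanishing of
Ext^i(C, C ⊗ Z_j) depends only on j - i, and it holds when j - i ≥ 2. Ultimate closure bounds
Ext^{i+m}(C, -) by the groups Ext^{i+k}(C, -) with k < m, so the range of j - i can be extended
downwards one step at a time, without limit. The conditions on the valuation map follow by diagram
chases.

The equivalence is then dimension shifting. Modules in the class are acyclic for Hom(-, C⁺), so a
resolution of length at most n kills Ext^{n+1}(N, C⁺). Conversely, if Ext^i(N, C⁺) = 0 for i > n,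
then the n-th syzygy of N lies in the class. -/

namespace SemidualizingBimodule

open Abelian

/-! ### Ext and short exact sequences of modules. -/

section ExtShift

variable {A : Type u} [Ring A]

/-- The linear maps `f` and `g` form a short exact sequence `0 → K → P → X → 0`. -/
structure IsShortExact {K P X : ModuleCat.{u} A} (f : K →ₗ[A] P) (g : P →ₗ[A] X) : Prop where
  injective : Function.Injective f
  exact : Function.Exact f g
  surjective : Function.Surjective g

/-- The short complex underlying a short exact sequence of linear maps. -/
abbrev IsShortExact.shortComplex {K P X : ModuleCat.{u} A} {f : K →ₗ[A] P} {g : P →ₗ[A] X}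
    (h : IsShortExact f g) : ShortComplex (ModuleCat.{u} A) :=
  ShortComplex.mk (ModuleCat.ofHom f) (ModuleCat.ofHom g) (by
    ext x
    exact h.exact.apply_apply_eq_zero x)

theorem IsShortExact.shortExact {K P X : ModuleCat.{u} A} {f : K →ₗ[A] P} {g : P →ₗ[A] X}
    (h : IsShortExact f g) : h.shortComplex.ShortExact where
  exact := (ShortComplex.ShortExact.moduleCat_exact_iff_function_exact _).2 h.exact
  mono_f := (ModuleCat.mono_iff_injective _).2 h.injective
  epi_g := (ModuleCat.epi_iff_surjective _).2 h.surjective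

theorem subsingleton_of_forall_eq_zero {G : Type*} [AddGroup G] (h : ∀ x : G, x = 0) :
    Subsingleton G :=
  ⟨fun x y => by rw [h x, h y]⟩

/-- Dimension shifting in the first variable. -/
theorem IsShortExact.ext_left_iff {K P X : ModuleCat.{u} A} {f : K →ₗ[A] P} {g : P →ₗ[A] X}
    (h : IsShortExact f g) (Y : ModuleCat.{u} A) (i : ℕ)
    (h₀ : Subsingleton (Ext P Y i)) (h₁ : Subsingleton (Ext P Y (i + 1))) :
    Subsingleton (Ext X Y (i + 1)) ↔ Subsingleton (Ext K Y i) := by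
  constructor
  · intro hX
    refine subsingleton_of_forall_eq_zero fun x => ?_
    obtain ⟨y, rfl⟩ := Ext.contravariant_sequence_exact₁ h.shortExact Y x (add_comm 1 i)
      (hX.elim _ _)
    rw [h₀.elim y 0]
    simp
  · intro hK
    refine subsingleton_of_forall_eq_zero fun x => ?_
    obtain ⟨y, rfl⟩ := Ext.contravariant_sequence_exact₃ h.shortExact Y x (h₁.elim _ _)
      (add_comm 1 i)
    rw [hK.elim y 0]
    simp

/-- Dimension shifting in the second variable. -/
theorem IsShortExact.ext_right_iff {K P X : ModuleCat.{u} A} {f : K →ₗ[A] P} {g : P →ₗ[A] X}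
    (h : IsShortExact f g) (Y : ModuleCat.{u} A) (i : ℕ)
    (h₀ : Subsingleton (Ext Y P i)) (h₁ : Subsingleton (Ext Y P (i + 1))) :
    Subsingleton (Ext Y K (i + 1)) ↔ Subsingleton (Ext Y X i) := by
  constructor
  · intro hX
    refine subsingleton_of_forall_eq_zero fun x => ?_
    obtain ⟨y, rfl⟩ := Ext.covariant_sequence_exact₃ Y h.shortExact x rfl (hX.elim _ _)
    rw [h₀.elim y 0]
    simp
  · intro hK
    refine subsingleton_of_forall_eq_zero fun x => ?_
    obtain ⟨y, rfl⟩ := Ext.covariant_sequence_exact₁ Y h.shortExact x (h₁.elim _ _) rfl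
    rw [hK.elim y 0]
    simp

/-- `Ext¹(X, Y)` vanishes if and only if every map from the kernel of `P → X` to `Y` extends to
`P`. -/
theorem IsShortExact.ext_one_left_iff {K P X : ModuleCat.{u} A} {f : K →ₗ[A] P} {g : P →ₗ[A] X}
    (h : IsShortExact f g) (Y : ModuleCat.{u} A) (h₁ : Subsingleton (Ext P Y 1)) :
    Subsingleton (Ext X Y 1) ↔ ∀ φ : K →ₗ[A] Y, ∃ ψ : P →ₗ[A] Y, ψ ∘ₗ f = φ := by
  constructor
  · intro hX φ
    obtain ⟨y, hy⟩ := Ext.contravariant_sequence_exact₁ h.shortExact Y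
      (Ext.mk₀ (ModuleCat.ofHom φ)) (add_comm 1 0) (hX.elim _ _)
    obtain ⟨ψ, rfl⟩ := Ext.homEquiv₀.symm.surjective y
    refine ⟨ψ.hom, ?_⟩
    have : ModuleCat.ofHom f ≫ ψ = ModuleCat.ofHom φ :=
      Ext.homEquiv₀.symm.injective (by simpa using hy)
    exact congrArg ModuleCat.Hom.hom this
  · intro hK
    refine subsingleton_of_forall_eq_zero fun x => ?_
    obtain ⟨y, rfl⟩ := Ext.contravariant_sequence_exact₃ h.shortExact Y x (h₁.elim _ _)
      (add_comm 1 0)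
    obtain ⟨φ, rfl⟩ := Ext.homEquiv₀.symm.surjective y
    obtain ⟨ψ, hψ⟩ := hK φ.hom
    have : φ = h.shortComplex.f ≫ ModuleCat.ofHom ψ := by
      ext1
      exact hψ.symm
    rw [this, Ext.homEquiv₀_symm_apply, ← Ext.mk₀_comp_mk₀]
    exact h.shortExact.extClass_comp_assoc _

/-- `Ext¹(Y, K)` vanishes if and only if every map from `Y` to the cokernel of `K → P` lifts to
`P`. -/
theorem IsShortExact.ext_one_right_iff {K P X : ModuleCat.{u} A} {f : K →ₗ[A] P} {g : P →ₗ[A] X}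
    (h : IsShortExact f g) (Y : ModuleCat.{u} A) (h₁ : Subsingleton (Ext Y P 1)) :
    Subsingleton (Ext Y K 1) ↔ ∀ φ : Y →ₗ[A] X, ∃ ψ : Y →ₗ[A] P, g ∘ₗ ψ = φ := by
  constructor
  · intro hX φ
    obtain ⟨y, hy⟩ := Ext.covariant_sequence_exact₃ Y h.shortExact
      (Ext.mk₀ (ModuleCat.ofHom φ)) rfl (hX.elim _ _)
    obtain ⟨ψ, rfl⟩ := Ext.homEquiv₀.symm.surjective y
    refine ⟨ψ.hom, ?_⟩
    have : ψ ≫ ModuleCat.ofHom g = ModuleCat.ofHom φ :=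
      Ext.homEquiv₀.symm.injective (by simpa using hy)
    exact congrArg ModuleCat.Hom.hom this
  · intro hK
    refine subsingleton_of_forall_eq_zero fun x => ?_
    obtain ⟨y, rfl⟩ := Ext.covariant_sequence_exact₁ Y h.shortExact x (h₁.elim _ _) (zero_add 1)
    obtain ⟨φ, rfl⟩ := Ext.homEquiv₀.symm.surjective y
    obtain ⟨ψ, hψ⟩ := hK φ.hom
    have : φ = ModuleCat.ofHom ψ ≫ h.shortComplex.g := by
      ext1
      exact hψ.symm
    rw [this, Ext.homEquiv₀_symm_apply, ← Ext.mk₀_comp_mk₀, Ext.comp_assoc_of_second_deg_zero,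
      h.shortExact.comp_extClass, Ext.comp_zero]

theorem subsingleton_ext_of_projective (P Y : ModuleCat.{u} A) [Projective P] (i : ℕ)
    (hi : 1 ≤ i) : Subsingleton (Ext P Y i) := by
  obtain ⟨i, rfl⟩ := Nat.exists_eq_add_of_le' hi
  exact Ext.subsingleton_of_projective P Y i

theorem subsingleton_ext_of_injective (Y I : ModuleCat.{u} A) [Injective I] (i : ℕ)
    (hi : 1 ≤ i) : Subsingleton (Ext Y I i) := by
  obtain ⟨i, rfl⟩ := Nat.exists_eq_add_of_le' hi
  exact Ext.subsingleton_of_injective Y I i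

theorem subsingleton_ext_left_of_retract {X W : ModuleCat.{u} A} (p : X →ₗ[A] W) (s : W →ₗ[A] X)
    (hps : p ∘ₗ s = LinearMap.id) (Y : ModuleCat.{u} A) (i : ℕ) (h : Subsingleton (Ext X Y i)) :
    Subsingleton (Ext W Y i) := by
  refine subsingleton_of_forall_eq_zero fun x => ?_
  have hid : ModuleCat.ofHom s ≫ ModuleCat.ofHom p = 𝟙 W := by
    ext1
    exact hps
  rw [← x.mk₀_id_comp, ← hid, ← Ext.mk₀_comp_mk₀, Ext.comp_assoc_of_second_deg_zero,
    h.elim ((Ext.mk₀ (ModuleCat.ofHom p)).comp x (zero_add i)) 0, Ext.comp_zero]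

theorem subsingleton_ext_right_of_retract {X W : ModuleCat.{u} A} (p : X →ₗ[A] W)
    (s : W →ₗ[A] X) (hps : p ∘ₗ s = LinearMap.id) (Y : ModuleCat.{u} A) (i : ℕ)
    (h : Subsingleton (Ext Y X i)) : Subsingleton (Ext Y W i) := by
  refine subsingleton_of_forall_eq_zero fun x => ?_
  have hid : ModuleCat.ofHom s ≫ ModuleCat.ofHom p = 𝟙 W := by
    ext1
    exact hps
  rw [← x.comp_mk₀_id, ← hid, ← Ext.mk₀_comp_mk₀, ← Ext.comp_assoc_of_third_deg_zero,
    h.elim (x.comp (Ext.mk₀ (ModuleCat.ofHom s)) (add_zero i)) 0, Ext.zero_comp]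

theorem subsingleton_ext_left_of_linearEquiv {X W : ModuleCat.{u} A} (e : X ≃ₗ[A] W)
    (Y : ModuleCat.{u} A) (i : ℕ) (h : Subsingleton (Ext X Y i)) : Subsingleton (Ext W Y i) :=
  subsingleton_ext_left_of_retract e.toLinearMap e.symm.toLinearMap (by simp) Y i h

theorem IsDirectSummand.subsingleton_ext {W M : ModuleCat.{u} A} (hW : IsDirectSummand W M)
    (Y : ModuleCat.{u} A) (i : ℕ) (h : Subsingleton (Ext M Y i)) : Subsingleton (Ext W Y i) := by
  obtain ⟨V, ⟨e⟩⟩ := hW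
  refine subsingleton_ext_left_of_retract (LinearMap.fst A W V ∘ₗ e.toLinearMap)
    (e.symm.toLinearMap ∘ₗ LinearMap.inl A W V) ?_ Y i h
  ext x
  simp

/-- Every module embeds into an injective module. -/
theorem exists_isShortExact_injective (M : ModuleCat.{u} A) :
    ∃ (I M' : ModuleCat.{u} A) (f : M →ₗ[A] I) (g : I →ₗ[A] M'),
      Injective I ∧ IsShortExact f g := by
  let j := Injective.ι M
  have hj : Function.Injective j.hom := (ModuleCat.mono_iff_injective j).1 inferInstance
  exact ⟨Injective.under M, ModuleCat.of A (_ ⧸ LinearMap.range j.hom), j.hom,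
    Submodule.mkQ _, inferInstance, hj, LinearMap.exact_map_mkQ_range _,
    Submodule.mkQ_surjective _⟩

/-- Every module is a quotient of a projective module. -/
theorem exists_isShortExact_projective (M : ModuleCat.{u} A) :
    ∃ (K P : ModuleCat.{u} A) (f : K →ₗ[A] P) (g : P →ₗ[A] M),
      Projective P ∧ IsShortExact f g := by
  let p := Projective.π M
  have hp : Function.Surjective p.hom := (ModuleCat.epi_iff_surjective p).1 inferInstance
  exact ⟨ModuleCat.of A (LinearMap.ker p.hom), Projective.over M, Submodule.subtype _, p.hom,
    inferInstance, Subtype.val_injective, LinearMap.exact_subtype_ker_map _, hp⟩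

/-- `Ext` out of a direct sum vanishes if it vanishes on every summand. -/
theorem subsingleton_ext_directSum {ι : Type u} (W : ι → ModuleCat.{u} A) (i : ℕ) (hi : 1 ≤ i) :
    ∀ Y : ModuleCat.{u} A, (∀ j, Subsingleton (Ext (W j) Y i)) →
      Subsingleton (Ext (ModuleCat.of A (⨁ j, W j)) Y i) := by
  classical
  induction i, hi using Nat.le_induction with
  | base =>
    intro Y hY
    -- With Y inside an injective I, vanishing of Ext¹(-, Y) is a lifting problem along I → I/Y, and
    -- lifts on the summands glue. Higher degrees shift to Y' = I/Y, which is why Y varies in the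
    -- induction.
    obtain ⟨I, Y', f, g, _, h⟩ := exists_isShortExact_injective Y
    rw [h.ext_one_right_iff _ (subsingleton_ext_of_injective _ _ _ le_rfl)]
    intro φ
    have hW j := (h.ext_one_right_iff _ (subsingleton_ext_of_injective _ _ _ le_rfl)).1 (hY j)
      (φ ∘ₗ DirectSum.lof A ι (fun j => W j) j)
    choose ψ hψ using hW
    refine ⟨DirectSum.toModule A ι I ψ, ?_⟩
    apply DirectSum.linearMap_ext
    intro j
    rw [← hψ j]
    ext x
    simp
  | succ i hi ih =>
    intro Y hY
    obtain ⟨I, Y', f, g, _, h⟩ := exists_isShortExact_injective Y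
    rw [h.ext_right_iff _ i (subsingleton_ext_of_injective _ _ _ hi)
      (subsingleton_ext_of_injective _ _ _ (by lia))]
    refine ih Y' fun j => ?_
    rw [← h.ext_right_iff _ i (subsingleton_ext_of_injective _ _ _ hi)
      (subsingleton_ext_of_injective _ _ _ (by lia))]
    exact hY j

end ExtShift

/-! ### Syzygies of a projective resolution. -/

section Resolution

variable {A : Type u} [Ring A] {X : ModuleCat.{u} A} (P : ProjectiveResolution X)

/-- The short exact sequences `0 → Im g_{k+1} → P_k → Im g_k → 0` of a projective resolution, and
the factorization `P_{k+1} → Im g_{k+1} → P_k` of the differential. -/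
theorem exists_isShortExact_resolutionImage (k : ℕ) :
    ∃ (f : resolutionImage P (k + 1) →ₗ[A] P.complex.X k)
      (g : P.complex.X k →ₗ[A] resolutionImage P k), IsShortExact f g ∧
        ∃ p : P.complex.X (k + 1) →ₗ[A] resolutionImage P (k + 1),
          Function.Surjective p ∧ f ∘ₗ p = (P.complex.d (k + 1) k).hom := by
  refine ⟨(LinearMap.range (P.complex.d (k + 1) k).hom).subtype, ?_⟩
  suffices h : ∃ g : P.complex.X k →ₗ[A] resolutionImage P k, Function.Surjective g ∧
      Function.Exact (P.complex.d (k + 1) k).hom g by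
    obtain ⟨g, hg, he⟩ := h
    refine ⟨g, ⟨Subtype.val_injective, ?_, hg⟩, LinearMap.rangeRestrict _,
      LinearMap.surjective_rangeRestrict _, rfl⟩
    intro y
    rw [he y]
    exact ⟨fun hy => ⟨⟨y, hy⟩, rfl⟩, fun ⟨z, hz⟩ => hz ▸ z.2⟩
  cases k with
  | zero =>
    refine ⟨(P.π.f 0).hom, ?_, ?_⟩
    · exact (ModuleCat.epi_iff_surjective _).1 inferInstance
    · exact (ShortComplex.ShortExact.moduleCat_exact_iff_function_exact _).1 P.exact₀
  | succ k =>
    refine ⟨(P.complex.d (k + 1) k).hom.rangeRestrict, LinearMap.surjective_rangeRestrict _, ?_⟩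
    have h := (ShortComplex.ShortExact.moduleCat_exact_iff_function_exact _).1 (P.exact_succ k)
    exact fun y => Subtype.ext_iff.trans (h y)

theorem subsingleton_ext_resolutionImage_succ_iff (Y : ModuleCat.{u} A) (k i : ℕ) (hi : 1 ≤ i) :
    Subsingleton (Ext (resolutionImage P k) Y (i + 1)) ↔
      Subsingleton (Ext (resolutionImage P (k + 1)) Y i) := by
  obtain ⟨f, g, h, -⟩ := exists_isShortExact_resolutionImage P k
  exact h.ext_left_iff Y i (subsingleton_ext_of_projective _ _ _ hi)
    (subsingleton_ext_of_projective _ _ _ (by lia))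

theorem subsingleton_ext_resolutionImage_iff (Y : ModuleCat.{u} A) (k i : ℕ) (hi : 1 ≤ i) :
    Subsingleton (Ext X Y (k + i)) ↔ Subsingleton (Ext (resolutionImage P k) Y i) := by
  induction k generalizing i with
  | zero => rw [zero_add]; rfl
  | succ k ih =>
    rw [← subsingleton_ext_resolutionImage_succ_iff P Y k i hi, ← ih _ (by lia)]
    rw [show k + 1 + i = k + (i + 1) by lia]

/-- `Ext^{k+1}(X, Y)` vanishes if and only if the complex `Hom(P, Y)` is exact in degree
`k + 1`. -/
theorem subsingleton_ext_succ_iff_hom_exact (Y : ModuleCat.{u} A) (k : ℕ) :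
    Subsingleton (Ext X Y (k + 1)) ↔
      ∀ φ : P.complex.X (k + 1) →ₗ[A] Y, φ ∘ₗ (P.complex.d (k + 2) (k + 1)).hom = 0 →
        ∃ ψ : P.complex.X k →ₗ[A] Y, ψ ∘ₗ (P.complex.d (k + 1) k).hom = φ := by
  obtain ⟨f, g, h, p, hp, hfp⟩ := exists_isShortExact_resolutionImage P k
  rw [subsingleton_ext_resolutionImage_iff P Y k 1 le_rfl,
    h.ext_one_left_iff Y (subsingleton_ext_of_projective _ _ _ le_rfl)]
  have hker : LinearMap.ker p = LinearMap.range (P.complex.d (k + 2) (k + 1)).hom := by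
    have hd := (ShortComplex.ShortExact.moduleCat_exact_iff_function_exact _).1 (P.exact_succ k)
    have hd' : LinearMap.ker (P.complex.d (k + 1) k).hom =
      LinearMap.range (P.complex.d (k + 2) (k + 1)).hom := LinearMap.exact_iff.1 hd
    rw [← hd', ← hfp, LinearMap.ker_comp_of_ker_eq_bot _ (LinearMap.ker_eq_bot.2 h.injective)]
  constructor
  -- A cocycle on P_{k+1} is the same as a map on the syzygy Im g_{k+1}; a coboundary is one that
  -- extends to P_k.
  · intro hext φ hφ
    have hle : LinearMap.ker p ≤ LinearMap.ker φ := by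
      rw [hker]
      rintro _ ⟨x, rfl⟩
      exact LinearMap.congr_fun hφ x
    obtain ⟨φ', hφ'⟩ : ∃ φ' : resolutionImage P (k + 1) →ₗ[A] Y, φ' ∘ₗ p = φ := by
      refine ⟨(LinearMap.ker p).liftQ φ hle ∘ₗ (p.quotKerEquivOfSurjective hp).symm.toLinearMap, ?_⟩
      ext x
      have : (p.quotKerEquivOfSurjective hp).symm (p x) = (LinearMap.ker p).mkQ x := by
        rw [LinearEquiv.symm_apply_eq]
        rfl
      simp [this]
    obtain ⟨ψ, hψ⟩ := hext φ'
    exact ⟨ψ, by rw [← hfp, ← hφ', ← hψ, LinearMap.comp_assoc]⟩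
  · intro hext φ
    obtain ⟨ψ, hψ⟩ := hext (φ ∘ₗ p) (by
      ext x
      have : p ((P.complex.d (k + 2) (k + 1)).hom x) = 0 := by
        rw [← LinearMap.mem_ker, hker]
        exact ⟨x, rfl⟩
      simp [this])
    refine ⟨ψ, ?_⟩
    rw [← hfp, ← LinearMap.comp_assoc] at hψ
    exact (LinearMap.cancel_right hp).1 hψ

theorem finite_resolutionImage (hP : ∀ i, Module.Finite A (P.complex.X i)) (k : ℕ) :
    Module.Finite A (resolutionImage P k) := by
  obtain ⟨f, g, h, -⟩ := exists_isShortExact_resolutionImage P k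
  have := hP k
  exact Module.Finite.of_surjective g h.surjective

/-- `Ext` out of a module with a degreewise finite projective resolution into a direct sum vanishes
if it vanishes into every summand. -/
theorem subsingleton_ext_into_directSum (hP : ∀ i, Module.Finite A (P.complex.X i)) {ι : Type u}
    (W : ι → ModuleCat.{u} A) (i : ℕ) (hi : 1 ≤ i) (hW : ∀ j, Subsingleton (Ext X (W j) i)) :
    Subsingleton (Ext X (ModuleCat.of A (⨁ j, W j)) i) := by
  classical
  obtain ⟨k, rfl⟩ := Nat.exists_eq_add_of_le' hi
  obtain ⟨f, g, h, -⟩ := exists_isShortExact_resolutionImage P k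
  simp only [subsingleton_ext_resolutionImage_iff P _ k 1 le_rfl,
    h.ext_one_left_iff _ (subsingleton_ext_of_projective _ _ _ le_rfl)] at hW ⊢
  intro φ
  choose ψ hψ using fun j => hW j (DirectSum.component A ι (fun j => W j) j ∘ₗ φ)
  have := finite_resolutionImage P hP (k + 1)
  obtain ⟨s, hs⟩ := this.fg_top
  -- The syzygy is finitely generated, so φ meets only finitely many summands, and a finite sum of
  -- componentwise extensions suffices.
  let F : Finset ι := s.biUnion fun x => DFinsupp.support (φ x)
  refine ⟨∑ j ∈ F, DirectSum.lof A ι (fun j => W j) j ∘ₗ ψ j, ?_⟩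
  apply LinearMap.ext_on hs
  intro x hx
  have hF : DFinsupp.support (φ x) ⊆ F := Finset.subset_biUnion_of_mem
    (fun x => DFinsupp.support (φ x)) hx
  have hψx j : ψ j (f x) = φ x j := LinearMap.congr_fun (hψ j) x
  simp only [LinearMap.comp_apply, LinearMap.sum_apply, hψx]
  have h1 := DirectSum.sum_support_of (φ x)
  conv_rhs => rw [← h1]
  symm
  apply Finset.sum_subset hF
  intro j _ hj
  have : φ x j = 0 := by simpa using hj
  rw [this, map_zero]

end Resolution

/-! ### Characters of abelian groups. -/

section Characters

theorem exists_character_of_notMem {B : Type*} [AddCommGroup B] (H : AddSubgroup B) {b : B}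
    (hb : b ∉ H) : ∃ χ : CharacterModule B, (∀ h ∈ H, χ h = 0) ∧ χ b ≠ 0 := by
  have hb' : (QuotientAddGroup.mk' H b) ≠ 0 := by simpa using hb
  obtain ⟨χ, hχ⟩ := CharacterModule.exists_character_apply_ne_zero_of_ne_zero hb'
  refine ⟨AddMonoidHom.comp χ (QuotientAddGroup.mk' H), fun h hh => ?_, hχ⟩
  have : QuotientAddGroup.mk' H h = 0 := by simpa using hh
  change χ (QuotientAddGroup.mk' H h) = 0
  rw [this]
  exact map_zero χ

/-- The character descends to the image of `g`, and ℚ/ℤ is divisible, hence injective. -/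
theorem exists_character_extension {B D : Type*} [AddCommGroup B] [AddCommGroup D] (g : B →+ D)
    (χ : CharacterModule B) (hχ : ∀ b, g b = 0 → χ b = 0) :
    ∃ ψ : CharacterModule D, ∀ b, ψ (g b) = χ b := by
  let χ' : g.range →+ AddCircle (1 : ℚ) :=
    AddMonoidHom.comp (QuotientAddGroup.lift g.ker χ hχ)
      (QuotientAddGroup.quotientKerEquivRange g).symm.toAddMonoidHom
  obtain ⟨ψ, hψ⟩ := (Module.Baer.of_divisible (AddCircle (1 : ℚ))).extension_property_addMonoidHom
    g.range.subtype Subtype.val_injective χ'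
  refine ⟨ψ, fun b => ?_⟩
  have h1 := DFunLike.congr_fun hψ ⟨g b, b, rfl⟩
  have h2 : (QuotientAddGroup.quotientKerEquivRange g).symm ⟨g b, b, rfl⟩ =
      QuotientAddGroup.mk b := by
    rw [AddEquiv.symm_apply_eq]
    rfl
  refine h1.trans ?_
  change QuotientAddGroup.lift g.ker χ hχ
    ((QuotientAddGroup.quotientKerEquivRange g).symm ⟨g b, b, rfl⟩) = χ b
  rw [h2]
  rfl

/-- A zero-composition sequence of abelian groups is exact if and only if its character dual is. -/
theorem exact_iff_character {A B D : Type*} [AddCommGroup A] [AddCommGroup B] [AddCommGroup D]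
    (f : A →+ B) (g : B →+ D) (hgf : ∀ a, g (f a) = 0) :
    Function.Exact f g ↔ ∀ χ : CharacterModule B, (∀ a, χ (f a) = 0) →
      ∃ ψ : CharacterModule D, ∀ b, ψ (g b) = χ b := by
  constructor
  · intro h χ hχ
    refine exists_character_extension g χ fun b hb => ?_
    obtain ⟨a, rfl⟩ := (h b).1 hb
    exact hχ a
  · intro h b
    constructor
    · intro hb
      by_contra hb'
      obtain ⟨χ, hχ, hne⟩ := exists_character_of_notMem f.range (b := b) hb'
      obtain ⟨ψ, hψ⟩ := h χ fun a => hχ _ ⟨a, rfl⟩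
      exact hne (by rw [← hψ, hb]; exact map_zero ψ)
    · rintro ⟨a, rfl⟩
      exact hgf a

end Characters

/-! ### The left S-module C⁺. -/

section Dual

/-- The character module `Hom_ℤ(C, ℚ/ℤ)` of a right `S`-module `C`, with the left `S`-module
structure `(s χ)(c) = χ(c s)`. -/
def CharacterDual (_S : Type u) (C : Type u) [AddCommGroup C] : Type u := CharacterModule C

variable (S C : Type u) [AddCommGroup C]

instance : AddCommGroup (CharacterDual S C) := inferInstanceAs (AddCommGroup (CharacterModule C))

instance : FunLike (CharacterDual S C) C (AddCircle (1 : ℚ)) :=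
  inferInstanceAs (FunLike (CharacterModule C) C (AddCircle (1 : ℚ)))

instance : AddMonoidHomClass (CharacterDual S C) C (AddCircle (1 : ℚ)) where
  map_add := AddMonoidHom.map_add
  map_zero := AddMonoidHom.map_zero

variable {S C} in
@[ext]
theorem CharacterDual.ext {χ χ' : CharacterDual S C} (h : ∀ c, χ c = χ' c) : χ = χ' :=
  DFunLike.ext _ _ h

@[simp]
theorem CharacterDual.add_apply (χ χ' : CharacterDual S C) (c : C) : (χ + χ') c = χ c + χ' c := rfl

@[simp]
theorem CharacterDual.zero_apply (c : C) : (0 : CharacterDual S C) c = 0 := rfl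

variable [Ring S] [Module Sᵐᵒᵖ C]

instance : Module S (CharacterDual S C) where
  smul s χ := AddMonoidHom.comp χ (DistribSMul.toAddMonoidHom C (MulOpposite.op s))
  one_smul χ := CharacterDual.ext fun c => congrArg χ (one_smul _ c)
  mul_smul s t χ := CharacterDual.ext fun c => congrArg χ
    (mul_smul (MulOpposite.op t) (MulOpposite.op s) c)
  smul_zero _ := rfl
  smul_add _ _ _ := rfl
  add_smul s t χ := CharacterDual.ext fun c =>
    (congrArg χ (add_smul (MulOpposite.op s) (MulOpposite.op t) c)).trans (map_add χ _ _)
  zero_smul χ := CharacterDual.ext fun c => (congrArg χ (zero_smul Sᵐᵒᵖ c)).trans (map_zero χ)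

@[simp]
theorem CharacterDual.smul_apply (s : S) (χ : CharacterDual S C) (c : C) :
    (s • χ) c = χ (MulOpposite.op s • c) := rfl

end Dual

/-! ### Characters of C ⊗ N as homomorphisms N → C⁺. -/

section BalancedTensor

variable {R S : Type u} [Ring R] [Ring S] {C : Type u} [AddCommGroup C] [Module R C]
  [Module Sᵐᵒᵖ C] {N : Type u} [AddCommGroup N] [Module S N]

@[elab_as_elim]
theorem balancedTensor_induction {p : BalancedTensor R S C N → Prop} (t : BalancedTensor R S C N)
    (zero : p 0) (tmul : ∀ c x, p (tmul R S c x)) (add : ∀ a b, p a → p b → p (a + b)) : p t := by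
  obtain ⟨t, rfl⟩ := Submodule.mkQ_surjective _ t
  induction t using TensorProduct.induction_on with
  | zero => simpa using zero
  | tmul c x => exact tmul c x
  | add a b ha hb => rw [map_add]; exact add _ _ ha hb

theorem tmul_add_left (c c' : C) (x : N) :
    tmul R S (c + c') x = tmul R S c x + tmul R S c' x := by
  simp [tmul, TensorProduct.add_tmul]

theorem tmul_add_right (c : C) (x x' : N) :
    tmul R S c (x + x') = tmul R S c x + tmul R S c x' := by
  simp [tmul, TensorProduct.tmul_add]

theorem tmul_zero_left (x : N) : tmul R S (0 : C) x = 0 := by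
  simp [tmul]

theorem tmul_zero_right (c : C) : tmul R S c (0 : N) = 0 := by
  simp [tmul]

theorem op_smul_tmul (s : S) (c : C) (x : N) :
    tmul R S (MulOpposite.op s • c) x = tmul R S c (s • x) := by
  rw [← sub_eq_zero, tmul, tmul, ← map_sub, Submodule.mkQ_apply, Submodule.Quotient.mk_eq_zero]
  exact Submodule.subset_span ⟨c, s, x, rfl⟩

/-- The `R`-linear map out of `C ⊗[S] N` induced by a balanced biadditive map that is `R`-linear in
the first variable. -/
noncomputable def balancedLift {X : Type u} [AddCommGroup X] [Module R X] (φ : C →ₗ[R] N →ₗ[ℤ] X)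
    (hφ : ∀ c (s : S) x, φ (MulOpposite.op s • c) x = φ c (s • x)) :
    BalancedTensor R S C N →ₗ[R] X :=
  (balancedRelations R S C N).liftQ (TensorProduct.AlgebraTensorModule.lift φ) (by
    rw [balancedRelations, Submodule.span_le]
    rintro _ ⟨c, s, x, rfl⟩
    simp [hφ])

theorem balancedLift_tmul {X : Type u} [AddCommGroup X] [Module R X] (φ : C →ₗ[R] N →ₗ[ℤ] X)
    (hφ : ∀ c (s : S) x, φ (MulOpposite.op s • c) x = φ c (s • x)) (c : C) (x : N) :
    balancedLift φ hφ (tmul R S c x) = φ c x := by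
  simp [balancedLift, tmul]

/-- The homomorphism `N → C⁺` corresponding to a character of `C ⊗[S] N`. -/
def characterCurry (χ : CharacterModule (BalancedTensor R S C N)) : N →ₗ[S] CharacterDual S C where
  toFun x :=
    (⟨⟨fun c => χ (tmul R S c x), by rw [tmul_zero_left, map_zero]⟩,
      fun c c' => by simp [tmul_add_left]⟩ : C →+ AddCircle (1 : ℚ))
  map_add' x x' := CharacterDual.ext fun c => by
    change χ (tmul R S c (x + x')) = χ (tmul R S c x) + χ (tmul R S c x')
    rw [tmul_add_right, map_add]
  map_smul' s x := CharacterDual.ext fun c => by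
    change χ (tmul R S c (s • x)) = χ (tmul R S (MulOpposite.op s • c) x)
    rw [op_smul_tmul]

@[simp]
theorem characterCurry_apply (χ : CharacterModule (BalancedTensor R S C N)) (x : N) (c : C) :
    characterCurry χ x c = χ (tmul R S c x) := rfl

theorem tensorMap_surjective {P X : Type u} [AddCommGroup P] [AddCommGroup X]
    [Module S P] [Module S X] (g : P →ₗ[S] X) (hg : Function.Surjective g) :
    Function.Surjective (tensorMap R S C g) := by
  intro t
  induction t using balancedTensor_induction with
  | zero => exact ⟨0, map_zero _⟩
  | tmul c x =>
    obtain ⟨p, rfl⟩ := hg x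
    exact ⟨tmul R S c p, tensorMap_tmul R C g c p⟩
  | add a b ha hb =>
    obtain ⟨a, rfl⟩ := ha
    obtain ⟨b, rfl⟩ := hb
    exact ⟨a + b, map_add _ _ _⟩

variable [SMulCommClass R Sᵐᵒᵖ C]

/-- With `characterCurry` this is the tensor-Hom adjunction, of which only existence is needed. -/
theorem exists_character_of_hom (φ : N →ₗ[S] CharacterDual S C) :
    ∃ χ : CharacterModule (BalancedTensor R S C N), ∀ c x, χ (tmul R S c x) = φ x c := by
  let φ₀ : C ⊗[ℤ] N →+ AddCircle (1 : ℚ) := TensorProduct.liftAddHom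
    ({ toFun := fun c =>
        { toFun := fun x => φ x c
          map_zero' := by simp
          map_add' := fun x x' => by simp }
       map_zero' := by ext x; exact map_zero (φ x)
       map_add' := fun c c' => by ext x; exact map_add (φ x) c c' } : C →+ N →+ AddCircle (1 : ℚ))
    (fun n c x => by
      change φ x (n • c) = φ (n • x) c
      rw [map_zsmul, map_zsmul]
      rfl)
  have hφ₀ c x : φ₀ (c ⊗ₜ x) = φ x c := rfl
  -- The relations are an R-span while `φ₀` is only additive, so the span induction must carry an
  -- arbitrary scalar `r`. Commutation of the two actions handles the generators.
  have hker : ∀ t ∈ balancedRelations R S C N, ∀ r : R, φ₀ (r • t) = 0 := by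
    intro t ht
    induction ht using Submodule.span_induction with
    | mem t ht =>
      obtain ⟨c, s, x, rfl⟩ := ht
      intro r
      rw [smul_sub, TensorProduct.smul_tmul', TensorProduct.smul_tmul', map_sub, hφ₀, hφ₀,
        smul_comm r (MulOpposite.op s) c, map_smul φ s x, CharacterDual.smul_apply, sub_self]
    | zero => simp
    | add a b _ _ ha hb =>
      intro r
      rw [smul_add, map_add, ha, hb, add_zero]
    | smul a t _ ht =>
      intro r
      rw [smul_smul, ht]
  exact ⟨QuotientAddGroup.lift (balancedRelations R S C N).toAddSubgroup φ₀
    (fun t ht => by simpa using hker t ht 1), fun c x => rfl⟩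

/-- Exactness is detected by characters, and characters of C ⊗ N are homomorphisms N → C⁺. -/
theorem exact_tensorMap_iff {A B D : Type u} [AddCommGroup A] [AddCommGroup B] [AddCommGroup D]
    [Module S A] [Module S B] [Module S D] (f : A →ₗ[S] B) (g : B →ₗ[S] D) (hgf : g ∘ₗ f = 0) :
    Function.Exact (tensorMap R S C f) (tensorMap R S C g) ↔
      ∀ φ : B →ₗ[S] CharacterDual S C, φ ∘ₗ f = 0 →
        ∃ ψ : D →ₗ[S] CharacterDual S C, ψ ∘ₗ g = φ := by
  refine (exact_iff_character (tensorMap R S C f).toAddMonoidHom (tensorMap R S C g).toAddMonoidHom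
    fun t => ?_).trans ?_
  · have : tensorMap R S C g ∘ₗ tensorMap R S C f = 0 := by
      apply balancedTensor_hom_ext
      intro c x
      have := LinearMap.congr_fun hgf x
      simp only [LinearMap.comp_apply, LinearMap.zero_apply] at this
      simp [tensorMap_tmul, this, tmul_zero_right]
    exact LinearMap.congr_fun this t
  · constructor
    · intro h φ hφ
      obtain ⟨χ, hχ⟩ := exists_character_of_hom (R := R) φ
      obtain ⟨ψ, hψ⟩ := h χ (fun t => by
        induction t using balancedTensor_induction with
        | zero => simp
        | tmul c x =>
          change χ (tensorMap R S C f (tmul R S c x)) = 0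
          rw [tensorMap_tmul, hχ]
          exact DFunLike.congr_fun (LinearMap.congr_fun hφ x) c
        | add a b ha hb => rw [map_add, map_add, ha, hb, add_zero])
      refine ⟨characterCurry ψ, ?_⟩
      ext x c
      have := hψ (tmul R S c x)
      change ψ (tensorMap R S C g (tmul R S c x)) = χ _ at this
      rw [tensorMap_tmul, hχ] at this
      exact this
    · intro h χ hχ
      obtain ⟨ψ, hψ⟩ := h (characterCurry χ) (by
        ext x c
        have := hχ (tmul R S c x)
        change χ (tensorMap R S C f (tmul R S c x)) = 0 at this
        rw [tensorMap_tmul] at this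
        exact this)
      obtain ⟨χ', hχ'⟩ := exists_character_of_hom (R := R) ψ
      refine ⟨χ', fun t => ?_⟩
      induction t using balancedTensor_induction with
      | zero => simp
      | tmul c x =>
        change χ' (tensorMap R S C g (tmul R S c x)) = _
        rw [tensorMap_tmul, hχ', ← characterCurry_apply, ← hψ]
        rfl
      | add a b ha hb => rw [map_add, map_add, ha, hb, map_add]

theorem tensorMap_injective_of_forall_extends {K P : Type u} [AddCommGroup K] [AddCommGroup P]
    [Module S K] [Module S P] (f : K →ₗ[S] P)
    (h : ∀ φ : K →ₗ[S] CharacterDual S C, ∃ ψ : P →ₗ[S] CharacterDual S C, ψ ∘ₗ f = φ) :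
    Function.Injective (tensorMap R S C f) := by
  -- Injectivity is exactness at K of 0 → K → P after tensoring.
  have hex := (exact_tensorMap_iff (R := R) (C := C) (0 : PUnit.{u + 1} →ₗ[S] K) f
    (by simp)).2 fun φ _ => h φ
  rw [injective_iff_map_eq_zero]
  intro t ht
  obtain ⟨y, rfl⟩ := (hex t).1 ht
  clear ht
  induction y using balancedTensor_induction with
  | zero => simp
  | tmul c x => rw [tensorMap_tmul, LinearMap.zero_apply, tmul_zero_right]
  | add a b ha hb => rw [map_add, ha, hb, add_zero]

end BalancedTensor

/-! ### Tor and exactness of C ⊗ - in terms of Ext into C⁺. -/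

section Tor

variable (R S : Type u) [Ring R] [Ring S] (C : Type u) [AddCommGroup C] [Module R C]
  [Module Sᵐᵒᵖ C] [SMulCommClass R Sᵐᵒᵖ C]

/-- `Tor_i(C, N)` vanishes if and only if `Ext^i(N, C⁺)` does, for `i ≥ 1`. -/
theorem isZero_bimoduleTor_iff (N : ModuleCat.{u} S) (i : ℕ) (hi : 1 ≤ i) :
    Limits.IsZero (bimoduleTor R S C i N) ↔
      Subsingleton (Ext N (ModuleCat.of S (CharacterDual S C)) i) := by
  obtain ⟨k, rfl⟩ := Nat.exists_eq_add_of_le' hi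
  let P := projectiveResolution N
  -- Both sides are computed from the one resolution `P`: exactness of C ⊗ P in degree k + 1 against
  -- exactness of Hom(P, C⁺) there.
  rw [subsingleton_ext_succ_iff_hom_exact P]
  refine (P.isoLeftDerivedObj (tensorFunctor R S C) (k + 1)).isZero_iff.trans ?_
  refine Iff.trans (HomologicalComplex.exactAt_iff_isZero_homology _ _).symm ?_
  rw [HomologicalComplex.exactAt_iff' _ (k + 2) (k + 1) k (by simp) (by simp)]
  refine (ShortComplex.ShortExact.moduleCat_exact_iff_function_exact _).trans ?_
  refine exact_tensorMap_iff (P.complex.d (k + 2) (k + 1)).hom (P.complex.d (k + 1) k).hom ?_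
  rw [← ModuleCat.hom_comp, P.complex.d_comp_d]
  rfl

end Tor

section TensorExact

variable {R S : Type u} [Ring R] [Ring S] {C : Type u} [AddCommGroup C] [Module R C]
  [Module Sᵐᵒᵖ C] [SMulCommClass R Sᵐᵒᵖ C]

/-- `C ⊗[S] -` preserves short exact sequences ending in a module `X` with `Ext¹(X, C⁺) = 0`. -/
theorem IsShortExact.tensorMap {K P X : ModuleCat.{u} S} {f : K →ₗ[S] P} {g : P →ₗ[S] X}
    (h : IsShortExact f g) [Projective P]
    (hX : Subsingleton (Ext X (ModuleCat.of S (CharacterDual S C)) 1)) :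
    IsShortExact (K := ModuleCat.of R (BalancedTensor R S C K))
      (P := ModuleCat.of R (BalancedTensor R S C P))
      (X := ModuleCat.of R (BalancedTensor R S C X))
      (tensorMap R S C f) (tensorMap R S C g) where
  -- Left exactness is where `hX` enters: it says that maps K → C⁺ extend to P.
  injective := tensorMap_injective_of_forall_extends f
    ((h.ext_one_left_iff _ (subsingleton_ext_of_projective _ _ _ le_rfl)).1 hX)
  exact := by
    refine (exact_tensorMap_iff f g h.exact.linearMap_comp_eq_zero).2 fun φ hφ => ?_
    have hle : LinearMap.ker g ≤ LinearMap.ker φ := by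
      intro x hx
      obtain ⟨y, rfl⟩ := (h.exact x).1 hx
      exact LinearMap.congr_fun hφ y
    refine ⟨(LinearMap.ker g).liftQ φ hle ∘ₗ
      (g.quotKerEquivOfSurjective h.surjective).symm.toLinearMap, ?_⟩
    ext1 x
    have : (g.quotKerEquivOfSurjective h.surjective).symm (g x) = (LinearMap.ker g).mkQ x := by
      rw [LinearEquiv.symm_apply_eq]
      rfl
    simp [this]
  surjective := tensorMap_surjective g h.surjective

end TensorExact

/-! ### Exactness of the character dual, and duals of projectives. -/

section DualMap

variable {S : Type u} [Ring S]

/-- The map of character modules induced by a homomorphism of right `S`-modules. -/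
def CharacterDual.map {C D : Type u} [AddCommGroup C] [AddCommGroup D] [Module Sᵐᵒᵖ C]
    [Module Sᵐᵒᵖ D] (f : C →ₗ[Sᵐᵒᵖ] D) : CharacterDual S D →ₗ[S] CharacterDual S C where
  toFun χ := AddMonoidHom.comp χ f.toAddMonoidHom
  map_add' _ _ := rfl
  map_smul' s χ := CharacterDual.ext fun c => congrArg χ (f.map_smul (MulOpposite.op s) c).symm

/-- The character dual of a short exact sequence is short exact. -/
theorem IsShortExact.characterDual {K F X : ModuleCat.{u} Sᵐᵒᵖ} {f : K →ₗ[Sᵐᵒᵖ] F}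
    {g : F →ₗ[Sᵐᵒᵖ] X} (h : IsShortExact f g) :
    IsShortExact (K := ModuleCat.of S (CharacterDual S X))
      (P := ModuleCat.of S (CharacterDual S F)) (X := ModuleCat.of S (CharacterDual S K))
      (CharacterDual.map g) (CharacterDual.map f) where
  injective χ χ' hχ := by
    refine CharacterDual.ext (S := S) fun x => ?_
    obtain ⟨y, rfl⟩ := h.surjective x
    exact DFunLike.congr_fun (F := CharacterDual S F) hχ y
  exact χ := by
    constructor
    · intro hχ
      obtain ⟨ψ, hψ⟩ := exists_character_extension g.toAddMonoidHom χ fun b hb => by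
        obtain ⟨k, rfl⟩ := (h.exact b).1 hb
        exact DFunLike.congr_fun (F := CharacterDual S K) hχ k
      exact ⟨ψ, CharacterDual.ext (S := S) hψ⟩
    · rintro ⟨ψ, rfl⟩
      refine CharacterDual.ext (S := S) fun k => ?_
      change (ψ : CharacterDual S X) (g (f k)) = 0
      rw [h.exact.apply_apply_eq_zero, map_zero]
  surjective χ := by
    obtain ⟨ψ, hψ⟩ := exists_character_extension f.toAddMonoidHom χ fun b hb => by
      have : b = 0 := h.injective (hb.trans (map_zero f).symm)
      rw [this]
      exact map_zero χ
    exact ⟨ψ, CharacterDual.ext (S := S) hψ⟩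

/-- The character dual of a projective right module is an injective left module. -/
theorem injective_characterDual (F : ModuleCat.{u} Sᵐᵒᵖ) [Projective F] :
    Injective (ModuleCat.of S (CharacterDual S F)) where
  factors {A B} φ j hj := by
    have hF : Module.Projective Sᵐᵒᵖ F := (IsProjective.iff_projective F).2 inferInstance
    obtain ⟨s, hs⟩ := hF.out
    have hj' : Function.Injective j := (ModuleCat.mono_iff_injective j).1 hj
    -- For each element of F, the functional on A is extended to B merely additively.
    have hχ (f : F) : ∃ χ : CharacterModule B, ∀ a, χ (j a) = φ.hom a f := by
      refine exists_character_extension j.hom.toAddMonoidHom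
        (⟨⟨fun a => φ.hom a f, by simp⟩, fun a b => by simp⟩ : A →+ AddCircle (1 : ℚ)) ?_
      intro a ha
      have : a = 0 := hj' (ha.trans (map_zero j.hom).symm)
      rw [this]
      exact DFunLike.congr_fun (map_zero φ.hom) f
    choose χ hχ using hχ
    -- On the free module over the set F, moving coefficients onto `b` turns the additive extensions
    -- into an S-linear map of B; the section `s` restricts it to F.
    let Ψ (b : B) : (F →₀ Sᵐᵒᵖ) →+ AddCircle (1 : ℚ) := Finsupp.liftAddHom fun f =>
      { toFun := fun t => χ f (t.unop • b)
        map_zero' := by simp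
        map_add' := fun t t' => by simp [add_smul] }
    have hΨ b (f : F) t : Ψ b (Finsupp.single f t) = χ f (t.unop • b) := by simp [Ψ]
    let ψ : B →ₗ[S] CharacterDual S F :=
      { toFun := fun b => ((Ψ b).comp s.toAddMonoidHom : F →+ AddCircle (1 : ℚ))
        map_add' := fun b b' => by
          have : Ψ (b + b') = Ψ b + Ψ b' := by
            ext f t
            simp [hΨ]
          ext f
          exact DFunLike.congr_fun this (s f)
        map_smul' := fun r b => by
          ext f
          change Ψ (r • b) (s f) = Ψ b (s (MulOpposite.op r • f))
          rw [map_smul]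
          induction s f using Finsupp.induction_linear with
          | zero => simp
          | add x y hx hy => rw [map_add, smul_add, map_add, hx, hy]
          | single f t =>
            rw [Finsupp.smul_single, hΨ, hΨ, smul_smul]
            rfl }
    refine ⟨ModuleCat.ofHom ψ, ?_⟩
    refine ModuleCat.hom_ext (LinearMap.ext fun a => CharacterDual.ext (S := S) fun f => ?_)
    change Ψ (j.hom a) (s f) = φ.hom a f
    have key (x : F →₀ Sᵐᵒᵖ) :
        Ψ (j.hom a) x = φ.hom a (Finsupp.linearCombination Sᵐᵒᵖ id x) := by
      induction x using Finsupp.induction_linear with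
      | zero => simp
      | add x y hx hy => rw [map_add, map_add, map_add, hx, hy]
      | single f t =>
        rw [hΨ, ← map_smul, Finsupp.linearCombination_single]
        refine (hχ f _).trans ?_
        rw [map_smul]
        rfl
    rw [key, hs]

end DualMap

/-! ### Projective dimension of a right module through its character dual. -/

section Villamayor

variable {S : Type u} [Ring S] {K F X : ModuleCat.{u} Sᵐᵒᵖ} {f : K →ₗ[Sᵐᵒᵖ] F}
  {g : F →ₗ[Sᵐᵒᵖ] X}

/-- If `F` is projective and the character dual of `F / K` is injective relative to left ideals,
then every element of `K` is fixed by a homomorphism `F → K`. -/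
theorem IsShortExact.exists_hom_apply_eq (h : IsShortExact f g) [Projective F]
    (hX : ∀ N : ModuleCat.{u} S,
      Subsingleton (Ext N (ModuleCat.of S (CharacterDual S X)) 1)) (u : K) :
    ∃ θ : F →ₗ[Sᵐᵒᵖ] K, θ (f u) = u := by
  classical
  have hF : Module.Projective Sᵐᵒᵖ F := (IsProjective.iff_projective F).2 inferInstance
  obtain ⟨s, hs⟩ := hF.out
  let E := (s (f u)).support
  have hfu : f u = ∑ e ∈ E, s (f u) e • e := by
    conv_lhs => rw [← hs (f u)]
    rw [Finsupp.linearCombination_apply]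
    rfl
  -- A solution of T k = f u yields θ: send the basis element e to k e and compose with the section
  -- `s`.
  let T : (F → K) →+ F :=
    { toFun := fun k => ∑ e ∈ E, s (f u) e • f (k e)
      map_zero' := by simp
      map_add' := fun k k' => by simp [Finset.sum_add_distrib] }
  by_cases hu : f u ∈ T.range
  · obtain ⟨k, hk⟩ := hu
    refine ⟨Finsupp.linearCombination Sᵐᵒᵖ k ∘ₗ s, h.injective ?_⟩
    rw [← hk, LinearMap.comp_apply, hk, Finsupp.linearCombination_apply, Finsupp.sum, map_sum]
    simp only [map_smul]
    exact hk
  · exfalso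
    obtain ⟨χ, hχ, hne⟩ := exists_character_of_notMem T.range hu
    -- Otherwise some character χ kills the range of T but not f u. With I the left ideal of the
    -- coefficients of f u, χ vanishes on K·I, so a ↦ (y ↦ χ(y a)) is a map I → X⁺. Extending it to
    -- S gives, at 1, a character of X that agrees with χ on F·I, which contains f u; but g (f u) =
    -- 0.
    let I : Submodule S S := Submodule.span S ((fun e => (s (f u) e).unop) '' (E : Set F))
    have hI : ∀ a ∈ I, ∀ k : K, χ (MulOpposite.op a • f k) = 0 := by
      intro a ha
      induction ha using Submodule.span_induction with
      | mem a ha =>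
        obtain ⟨e, he, rfl⟩ := ha
        intro k
        refine hχ _ ⟨Pi.single e k, ?_⟩
        change ∑ e' ∈ E, s (f u) e' • f ((Pi.single e k : F → K) e') = _
        rw [Finset.sum_eq_single_of_mem e he]
        · simp
        · intro e' _ hne'
          simp [Pi.single_eq_of_ne hne']
      | zero => simp
      | add a b _ _ ha hb =>
        intro k
        rw [MulOpposite.op_add, add_smul, map_add, ha, hb, add_zero]
      | smul r a _ ha =>
        intro k
        rw [smul_eq_mul, MulOpposite.op_mul, mul_smul, ← map_smul]
        exact ha _
    have hη (a : I) : ∃ η : CharacterDual S X, ∀ y, η (g y) = χ (MulOpposite.op (a : S) • y) := by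
      refine exists_character_extension g.toAddMonoidHom
        (AddMonoidHom.comp χ (DistribSMul.toAddMonoidHom F (MulOpposite.op (a : S)))) ?_
      intro y hy
      obtain ⟨k, rfl⟩ := (h.exact y).1 hy
      exact hI a a.2 k
    choose η hη using hη
    let φ : I →ₗ[S] CharacterDual S X :=
      { toFun := η
        map_add' := fun a b => by
          ext x
          obtain ⟨y, rfl⟩ := h.surjective x
          simp [hη, add_smul]
        map_smul' := fun r a => by
          ext x
          obtain ⟨y, rfl⟩ := h.surjective x
          rw [hη, RingHom.id_apply, CharacterDual.smul_apply, ← map_smul, hη, smul_smul]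
          rfl }
    have hses : IsShortExact (K := ModuleCat.of S I) (P := ModuleCat.of S S)
        (X := ModuleCat.of S (S ⧸ I)) I.subtype I.mkQ :=
      ⟨Subtype.val_injective, LinearMap.exact_subtype_mkQ I, Submodule.mkQ_surjective I⟩
    have hproj : Projective (ModuleCat.of S S) :=
      (IsProjective.iff_projective (R := S) S).1 inferInstance
    obtain ⟨ψ, hψ⟩ := (hses.ext_one_left_iff (ModuleCat.of S (CharacterDual S X))
      (subsingleton_ext_of_projective _ _ _ le_rfl)).1 (hX _) φ
    have hψ' (a : I) (y : F) : χ (MulOpposite.op (a : S) • y) =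
        ψ (1 : S) (g (MulOpposite.op (a : S) • y)) := by
      rw [← hη, map_smul, ← CharacterDual.smul_apply, ← map_smul, smul_eq_mul, mul_one]
      exact (DFunLike.congr_fun (LinearMap.congr_fun hψ a) (g y)).symm
    apply hne
    have hsum : χ (f u) = ψ (1 : S) (g (f u)) := by
      rw [hfu, map_sum, map_sum, map_sum]
      refine Finset.sum_congr rfl fun e he => ?_
      exact hψ' ⟨(s (f u) e).unop, Submodule.subset_span ⟨e, he, rfl⟩⟩ e
    rw [hsum, h.exact.apply_apply_eq_zero, map_zero]

/-- A finitely generated submodule `K` of `F` is a retract of `F` if every element of `K` is fixed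
by some homomorphism `F → K`. -/
theorem exists_retraction_of_forall_exists_hom [Module.Finite Sᵐᵒᵖ K]
    (hf : ∀ u : K, ∃ θ : F →ₗ[Sᵐᵒᵖ] K, θ (f u) = u) :
    ∃ θ : F →ₗ[Sᵐᵒᵖ] K, θ ∘ₗ f = LinearMap.id := by
  classical
  obtain ⟨s, hs⟩ := ‹Module.Finite Sᵐᵒᵖ K›.fg_top
  suffices H : ∀ t : Finset K, ∃ θ : F →ₗ[Sᵐᵒᵖ] K, ∀ u ∈ t, θ (f u) = u by
    obtain ⟨θ, hθ⟩ := H s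
    exact ⟨θ, LinearMap.ext_on hs fun u hu => hθ u hu⟩
  intro t
  induction t using Finset.induction_on with
  | empty => exact ⟨0, by simp⟩
  | insert u t _ ih =>
    obtain ⟨θ₁, h₁⟩ := ih
    obtain ⟨θ₂, h₂⟩ := hf (u - θ₁ (f u))
    -- Chosen so that 1 - θf = (1 - θ₂f)(1 - θ₁f): the right factor kills `t`, and the left one
    -- kills what remains of `u`.
    refine ⟨θ₁ + θ₂ - θ₂ ∘ₗ f ∘ₗ θ₁, fun w hw => ?_⟩
    rcases Finset.mem_insert.1 hw with rfl | hw
    · simp only [map_sub] at h₂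
      simp only [LinearMap.sub_apply, LinearMap.add_apply, LinearMap.comp_apply]
      rw [add_sub_assoc, h₂, add_sub_cancel]
    · simp [h₁ w hw]

/-- Finite generation of K merges the elementwise maps into one retraction, so the sequence splits.
-/
theorem IsShortExact.projective_of_characterDual (h : IsShortExact f g) [Projective F]
    [Module.Finite Sᵐᵒᵖ K]
    (hX : ∀ N : ModuleCat.{u} S,
      Subsingleton (Ext N (ModuleCat.of S (CharacterDual S X)) 1)) : Projective X := by
  obtain ⟨θ, hθ⟩ := exists_retraction_of_forall_exists_hom (f := f) (h.exists_hom_apply_eq hX)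
  rw [projective_iff_subsingleton_ext_one]
  intro Y
  rw [h.ext_one_left_iff Y (subsingleton_ext_of_projective _ _ _ le_rfl)]
  intro φ
  exact ⟨φ ∘ₗ θ, by rw [LinearMap.comp_assoc, hθ, LinearMap.comp_id]⟩

/-- For a right module with a degreewise finite projective resolution, projective dimension is the
injective dimension of the character dual. -/
theorem forall_subsingleton_ext_characterDual_iff {C : ModuleCat.{u} Sᵐᵒᵖ}
    (P : ProjectiveResolution C) (hP : ∀ i, Module.Finite Sᵐᵒᵖ (P.complex.X i)) (n k : ℕ) :
    (∀ N : ModuleCat.{u} S, Subsingleton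
      (Ext N (ModuleCat.of S (CharacterDual S (resolutionImage P k))) (n + 1))) ↔
      HasProjectiveDimensionLT (resolutionImage P k) (n + 1) := by
  induction n generalizing k with
  | zero =>
    obtain ⟨f, g, h, -⟩ := exists_isShortExact_resolutionImage P k
    have := finite_resolutionImage P hP (k + 1)
    rw [← projective_iff_hasProjectiveDimensionLT_one]
    constructor
    · exact h.projective_of_characterDual
    · intro _ N
      have := injective_characterDual (resolutionImage P k)
      exact subsingleton_ext_of_injective _ _ _ le_rfl
  | succ n ih =>
    obtain ⟨f, g, h, -⟩ := exists_isShortExact_resolutionImage P k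
    have := injective_characterDual (P.complex.X k)
    rw [h.shortExact.hasProjectiveDimensionLT_X₃_iff n (P.projective k)]
    -- The dual of P_k is injective, so lowering the Ext degree by one replaces the k-th syzygy by
    -- the next.
    refine Iff.trans (forall_congr' fun N => ?_) (ih (k + 1))
    exact h.characterDual.ext_right_iff N (n + 1)
      (subsingleton_ext_of_injective _ _ _ (by lia))
      (subsingleton_ext_of_injective _ _ _ (by lia))

end Villamayor

/-! ### The valuation map and Ext on projective modules. -/

section Valuation

variable {R S : Type u} [Ring R] [Ring S] {C : Type u} [AddCommGroup C] [Module R C]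
  [Module Sᵐᵒᵖ C]

@[simp]
theorem valuation_apply_apply {N : Type u} [AddCommGroup N] [Module S N] (x : N) (c : C) :
    valuation R S C N x c = tmul R S c x := rfl

theorem valuation_map {N N' : Type u} [AddCommGroup N] [Module S N] [AddCommGroup N']
    [Module S N'] (f : N →ₗ[S] N') (x : N) :
    valuation R S C N' (f x) = tensorMap R S C f ∘ₗ valuation R S C N x := by
  ext c
  exact (tensorMap_tmul R C f c x).symm

theorem tensorMap_comp_eq_id {N N' : Type u} [AddCommGroup N] [Module S N] [AddCommGroup N']
    [Module S N'] (s : N →ₗ[S] N') (p : N' →ₗ[S] N) (hps : p ∘ₗ s = LinearMap.id) :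
    tensorMap R S C p ∘ₗ tensorMap R S C s = LinearMap.id := by
  apply balancedTensor_hom_ext
  intro c x
  have := LinearMap.congr_fun hps x
  simp only [LinearMap.comp_apply, LinearMap.id_apply] at this
  simp [tensorMap_tmul, this]

variable [SMulCommClass R Sᵐᵒᵖ C]

variable (R S C) in
/-- The coordinates `C ⊗[S] S^(J) → C^(J)`. -/
noncomputable def freeTensorCoord (J : Type u) : BalancedTensor R S C (J →₀ S) →ₗ[R] (J →₀ C) :=
  balancedLift
    { toFun := fun c => (Finsupp.mapRange.addMonoidHom
        (⟨⟨fun s : S => MulOpposite.op s • c, by simp⟩, fun s t => by simp [add_smul]⟩ :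
          S →+ C)).toIntLinearMap
      map_add' := fun c c' => by
        ext x j
        simp
      map_smul' := fun r c => by
        ext x j
        simp [smul_comm] }
    (fun c s x => by
      ext j
      simp [mul_smul])

@[simp]
theorem freeTensorCoord_tmul (J : Type u) (c : C) (x : J →₀ S) (j : J) :
    freeTensorCoord R S C J (tmul R S c x) j = MulOpposite.op (x j) • c := by
  rw [freeTensorCoord, balancedLift_tmul]
  simp

variable (R S C) in
/-- The inverse `C^(J) → C ⊗[S] S^(J)` of `freeTensorCoord`. -/
noncomputable def freeTensorOfCoord (J : Type u) :
    (J →₀ C) →ₗ[R] BalancedTensor R S C (J →₀ S) :=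
  Finsupp.lsum ℕ fun j => valuation R S C (J →₀ S) (Finsupp.single j 1)

/-- This composite alone suffices: it makes the coordinates injective and C ⊗ S^(J) a retract of
C^(J). -/
theorem freeTensorOfCoord_comp_coord (J : Type u) :
    freeTensorOfCoord R S C J ∘ₗ freeTensorCoord R S C J = LinearMap.id := by
  apply balancedTensor_hom_ext
  intro c x
  have hsingle (j : J) (s : S) : freeTensorCoord R S C J (tmul R S c (Finsupp.single j s)) =
      Finsupp.single j (MulOpposite.op s • c) := by
    classical
    ext j'
    rw [freeTensorCoord_tmul]
    by_cases h : j = j'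
    · subst h
      simp
    · simp [Finsupp.single_eq_of_ne' h]
  induction x using Finsupp.induction_linear with
  | zero => simp [tmul_zero_right]
  | add x y hx hy => rw [tmul_add_right, map_add, map_add, hx, hy]
  | single j s =>
    rw [LinearMap.comp_apply, hsingle, freeTensorOfCoord, Finsupp.lsum_single,
      valuation_apply_apply, op_smul_tmul]
    simp

theorem IsSemidualizing.finite (hC : IsSemidualizing R S C) : Module.Finite R C := by
  obtain ⟨P, hP⟩ := hC.finite_left
  exact finite_resolutionImage P hP 0

theorem IsSemidualizing.eq_zero_of_forall_op_smul (hC : IsSemidualizing R S C) {s : S}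
    (hs : ∀ c : C, MulOpposite.op s • c = 0) : s = 0 := by
  refine hC.homothety_right.1 ?_
  ext c
  have : MulOpposite.op s • c = MulOpposite.op (0 : S) • c := by rw [hs c]; simp
  exact this

theorem IsSemidualizing.exists_op_smul_eq (hC : IsSemidualizing R S C) (f : C →ₗ[R] C) :
    ∃ s : S, ∀ c, f c = MulOpposite.op s • c := by
  obtain ⟨s, hs⟩ := hC.homothety_right.2 f
  exact ⟨s, fun c => (LinearMap.congr_fun hs c).symm⟩

/-- In each coordinate this is the homothety S ≅ Hom_R(C, C). Finite generation of C makes the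
resulting family of scalars finitely supported. -/
theorem IsSemidualizing.valuation_bijective_free (hC : IsSemidualizing R S C) (J : Type u) :
    Function.Bijective (valuation R S C (J →₀ S)) := by
  classical
  constructor
  · rw [injective_iff_map_eq_zero]
    intro x hx
    ext j
    refine hC.eq_zero_of_forall_op_smul fun c => ?_
    rw [← freeTensorCoord_tmul (R := R), ← valuation_apply_apply, hx]
    simp
  · intro f
    choose s hs using fun j => hC.exists_op_smul_eq
      (Finsupp.lapply j ∘ₗ freeTensorCoord R S C J ∘ₗ f)
    obtain ⟨t, ht⟩ := hC.finite.fg_top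
    let F : Finset J := t.biUnion fun c => (freeTensorCoord R S C J (f c)).support
    refine ⟨Finsupp.indicator F fun j _ => s j, LinearMap.ext_on ht fun c hc => ?_⟩
    have hinj : Function.Injective (freeTensorCoord R S C J) :=
      Function.LeftInverse.injective (g := freeTensorOfCoord R S C J)
        (LinearMap.congr_fun (freeTensorOfCoord_comp_coord (R := R) (S := S) (C := C) J))
    apply hinj
    ext j
    rw [valuation_apply_apply, freeTensorCoord_tmul, Finsupp.indicator_apply]
    split_ifs with hj
    · exact (hs j c).symm
    · have : j ∉ (freeTensorCoord R S C J (f c)).support := fun h =>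
        hj (Finset.mem_biUnion.2 ⟨c, hc, h⟩)
      rw [Finsupp.notMem_support_iff.1 this]
      simp

theorem IsSemidualizing.valuation_bijective_projective (hC : IsSemidualizing R S C)
    (P : ModuleCat.{u} S) [Projective P] : Function.Bijective (valuation R S C P) := by
  have hP : Module.Projective S P := (IsProjective.iff_projective P).2 inferInstance
  obtain ⟨s, hs⟩ := hP.out
  have hps : Finsupp.linearCombination S id ∘ₗ s = LinearMap.id := LinearMap.ext hs
  constructor
  · rw [injective_iff_map_eq_zero]
    intro x hx
    have h0 : s x = 0 := by
      refine (hC.valuation_bijective_free P).1 ?_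
      rw [valuation_map, hx, map_zero, LinearMap.comp_zero]
    rw [← hs x, h0, map_zero]
  · intro f
    obtain ⟨y, hy⟩ := (hC.valuation_bijective_free P).2 (tensorMap R S C s ∘ₗ f)
    refine ⟨Finsupp.linearCombination S id y, ?_⟩
    rw [valuation_map, hy, ← LinearMap.comp_assoc, tensorMap_comp_eq_id _ _ hps,
      LinearMap.id_comp]

/-- C ⊗ P is a retract of a direct sum of copies of C, and Ext^i(C, -) respects vanishing on direct
sums because C has a degreewise finite resolution. -/
theorem IsSemidualizing.subsingleton_ext_tensor_projective (hC : IsSemidualizing R S C)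
    (P : ModuleCat.{u} S) [Projective P] (i : ℕ) (hi : 1 ≤ i) :
    Subsingleton (Ext (ModuleCat.of R C) (ModuleCat.of R (BalancedTensor R S C P)) i) := by
  classical
  have hP : Module.Projective S P := (IsProjective.iff_projective P).2 inferInstance
  obtain ⟨s, hs⟩ := hP.out
  have hps : Finsupp.linearCombination S id ∘ₗ s = LinearMap.id := LinearMap.ext hs
  obtain ⟨Q, hQ⟩ := hC.finite_left
  have h1 := subsingleton_ext_into_directSum Q hQ (fun _ : P => ModuleCat.of R C) i hi
    fun _ => hC.ext_left i hi
  have h2 : Subsingleton (Ext (ModuleCat.of R C) (ModuleCat.of R (P →₀ C)) i) :=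
    subsingleton_ext_right_of_retract (X := ModuleCat.of R (⨁ _ : P, C))
      (W := ModuleCat.of R (P →₀ C)) (finsuppLEquivDirectSum R C P).symm.toLinearMap
      (finsuppLEquivDirectSum R C P).toLinearMap (by simp) _ i h1
  have h3 : Subsingleton (Ext (ModuleCat.of R C)
      (ModuleCat.of R (BalancedTensor R S C (P →₀ S))) i) :=
    subsingleton_ext_right_of_retract (X := ModuleCat.of R (P →₀ C))
      (W := ModuleCat.of R (BalancedTensor R S C (P →₀ S)))
      (freeTensorOfCoord R S C P) (freeTensorCoord R S C P)
      (freeTensorOfCoord_comp_coord (P : Type u)) _ i h2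
  exact subsingleton_ext_right_of_retract
    (X := ModuleCat.of R (BalancedTensor R S C (P →₀ S)))
    (W := ModuleCat.of R (BalancedTensor R S C P)) _ _
    (tensorMap_comp_eq_id _ _ hps) _ i h3

theorem IsSemidualizing.auslanderClass_of_projective (hC : IsSemidualizing R S C)
    (P : ModuleCat.{u} S) [Projective P] : auslanderClass R S C P where
  tor_eq_zero i hi := (isZero_bimoduleTor_iff R S C P i hi).2
    (subsingleton_ext_of_projective _ _ i hi)
  ext_eq_zero i hi := hC.subsingleton_ext_tensor_projective P i hi
  valuation_bijective := hC.valuation_bijective_projective P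

/-! ### Comparing a module with its syzygy. -/

section Syzygy

variable {K P N : ModuleCat.{u} S} {f : K →ₗ[S] P} {g : P →ₗ[S] N}

theorem IsSemidualizing.valuation_injective_of_isShortExact (hC : IsSemidualizing R S C)
    (h : IsShortExact f g) [Projective P] : Function.Injective (valuation R S C K) := by
  rw [injective_iff_map_eq_zero]
  intro x hx
  refine h.injective ((hC.valuation_bijective_projective P).1 ?_)
  rw [valuation_map, hx, LinearMap.comp_zero, map_zero, map_zero]

/-- This and the next lemmas chase the valuation maps from K → P → N to Hom_R(C, C ⊗ -), where the
middle one is bijective. -/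
theorem IsSemidualizing.valuation_surjective_of_injective (hC : IsSemidualizing R S C)
    (h : IsShortExact f g) [Projective P]
    (hN : Subsingleton (Ext N (ModuleCat.of S (CharacterDual S C)) 1))
    (hinj : Function.Injective (valuation R S C N)) :
    Function.Surjective (valuation R S C K) := by
  intro φ
  have hT := h.tensorMap (R := R) (C := C) hN
  obtain ⟨q, hq⟩ := (hC.valuation_bijective_projective P).2 (tensorMap R S C f ∘ₗ φ)
  have hgq : g q = 0 := by
    refine hinj ?_
    rw [valuation_map, hq, map_zero]
    ext c
    exact hT.exact.apply_apply_eq_zero (φ c)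
  obtain ⟨k, rfl⟩ := (h.exact q).1 hgq
  refine ⟨k, ?_⟩
  rw [valuation_map] at hq
  ext c
  exact hT.injective (LinearMap.congr_fun hq c)

theorem IsSemidualizing.subsingleton_ext_one_tensor (hC : IsSemidualizing R S C)
    (h : IsShortExact f g) [Projective P]
    (hN : Subsingleton (Ext N (ModuleCat.of S (CharacterDual S C)) 1))
    (hsurj : Function.Surjective (valuation R S C N)) :
    Subsingleton (Ext (ModuleCat.of R C) (ModuleCat.of R (BalancedTensor R S C K)) 1) := by
  rw [(h.tensorMap (R := R) (C := C) hN).ext_one_right_iff _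
    (hC.subsingleton_ext_tensor_projective P 1 le_rfl)]
  intro φ
  obtain ⟨x, hx⟩ := hsurj φ
  obtain ⟨q, rfl⟩ := h.surjective x
  exact ⟨valuation R S C P q, by rw [← valuation_map, hx]⟩

theorem IsSemidualizing.valuation_surjective_of_ext_one (hC : IsSemidualizing R S C)
    (h : IsShortExact f g) [Projective P]
    (hN : Subsingleton (Ext N (ModuleCat.of S (CharacterDual S C)) 1))
    (hK : Subsingleton (Ext (ModuleCat.of R C) (ModuleCat.of R (BalancedTensor R S C K)) 1)) :
    Function.Surjective (valuation R S C N) := by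
  intro φ
  obtain ⟨ψ, hψ⟩ := ((h.tensorMap (R := R) (C := C) hN).ext_one_right_iff (ModuleCat.of R C)
    (hC.subsingleton_ext_tensor_projective P 1 le_rfl)).1 hK φ
  obtain ⟨q, rfl⟩ := (hC.valuation_bijective_projective P).2 ψ
  exact ⟨g q, by rw [valuation_map, ← hψ]⟩

theorem IsSemidualizing.valuation_injective_of_surjective (hC : IsSemidualizing R S C)
    (h : IsShortExact f g) [Projective P]
    (hN : Subsingleton (Ext N (ModuleCat.of S (CharacterDual S C)) 1))
    (hK : Function.Surjective (valuation R S C K)) :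
    Function.Injective (valuation R S C N) := by
  rw [injective_iff_map_eq_zero]
  intro x hx
  obtain ⟨q, rfl⟩ := h.surjective x
  have hT := h.tensorMap (R := R) (C := C) hN
  have hmem (c : C) : ∃ t, tensorMap R S C f t = valuation R S C P q c := by
    refine (hT.exact _).1 ?_
    rw [valuation_map] at hx
    exact LinearMap.congr_fun hx c
  choose t ht using hmem
  -- The preimages are unique because C ⊗ K → C ⊗ P is injective, so they form a linear map.
  let φ : C →ₗ[R] BalancedTensor R S C K :=
    { toFun := t
      map_add' := fun c c' => hT.injective (by
        change tensorMap R S C f _ = tensorMap R S C f _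
        rw [map_add, ht, ht, ht, map_add])
      map_smul' := fun r c => hT.injective (by
        change tensorMap R S C f _ = tensorMap R S C f _
        rw [RingHom.id_apply, map_smul, ht, ht, map_smul]) }
  obtain ⟨k, hk⟩ := hK φ
  have : f k = q := by
    refine (hC.valuation_bijective_projective P).1 ?_
    rw [valuation_map, hk]
    ext c
    exact ht c
  rw [← this, h.exact.apply_apply_eq_zero]

theorem IsSemidualizing.subsingleton_ext_tensor_succ_iff (hC : IsSemidualizing R S C)
    (h : IsShortExact f g) [Projective P]
    (hN : Subsingleton (Ext N (ModuleCat.of S (CharacterDual S C)) 1)) (i : ℕ) (hi : 1 ≤ i) :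
    Subsingleton (Ext (ModuleCat.of R C) (ModuleCat.of R (BalancedTensor R S C K)) (i + 1)) ↔
      Subsingleton (Ext (ModuleCat.of R C) (ModuleCat.of R (BalancedTensor R S C N)) i) :=
  (h.tensorMap (R := R) (C := C) hN).ext_right_iff _ i
    (hC.subsingleton_ext_tensor_projective P i hi)
    (hC.subsingleton_ext_tensor_projective P (i + 1) (by lia))

end Syzygy

/-- If `C` has an ultimately closed projective resolution, then every module `N` with
`Tor_i(C, N) = 0` for all `i ≥ 1`, that is, with `Ext^i(N, C⁺) = 0`, lies in the Auslander class. -/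
theorem IsSemidualizing.auslanderClass_of_ext_characterDual (hC : IsSemidualizing R S C)
    (hclosed : HasUltimatelyClosedResolution (ModuleCat.of R C)) (N : ModuleCat.{u} S)
    (hN : ∀ i, 1 ≤ i → Subsingleton (Ext N (ModuleCat.of S (CharacterDual S C)) i)) :
    auslanderClass R S C N := by
  obtain ⟨m, -, P, ι, W, ⟨e⟩, hW⟩ := hclosed
  let Q := projectiveResolution N
  let Z := resolutionImage Q
  have hZ (k : ℕ) : Subsingleton (Ext (Z k) (ModuleCat.of S (CharacterDual S C)) 1) :=
    (subsingleton_ext_resolutionImage_iff Q _ k 1 le_rfl).1 (hN _ (by lia))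
  choose f g h _ using exists_isShortExact_resolutionImage Q
  -- Each step to a further syzygy gains one property: injectivity, then surjectivity, then
  -- vanishing of Ext¹.
  have hinj (k : ℕ) : Function.Injective (valuation R S C (Z (k + 1))) :=
    hC.valuation_injective_of_isShortExact (h k)
  have hsurj (k : ℕ) : Function.Surjective (valuation R S C (Z (k + 2))) :=
    hC.valuation_surjective_of_injective (h (k + 1)) (hZ (k + 1)) (hinj k)
  let V (i j : ℕ) : Prop := Subsingleton
    (Ext (ModuleCat.of R C) (ModuleCat.of R (BalancedTensor R S C (Z j))) i)
  have hbase (k : ℕ) : V 1 (k + 3) :=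
    hC.subsingleton_ext_one_tensor (h (k + 2)) (hZ (k + 2)) (hsurj k)
  have hshift (a i j : ℕ) (hi : 1 ≤ i) : V (i + a) (j + a) ↔ V i j := by
    induction a with
    | zero => rfl
    | succ a ih =>
      rw [← ih]
      exact hC.subsingleton_ext_tensor_succ_iff (h (j + a)) (hZ (j + a)) (i + a) (by lia)
  -- By `hshift` only j - i matters, and `t` measures how far it may fall below the initial bound 2.
  have hV (t : ℕ) : ∀ i j, 1 ≤ i → i + 2 ≤ j + t → V i j := by
    induction t with
    | zero =>
      intro i j hi hij
      obtain ⟨i, rfl⟩ := Nat.exists_eq_add_of_le hi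
      obtain ⟨k, rfl⟩ := Nat.exists_eq_add_of_le hij
      have := (hshift i 1 (k + 3) le_rfl).2 (hbase k)
      rwa [show k + 3 + i = 1 + i + 2 + k by lia] at this
    | succ t ih =>
      intro i j hi hij
      -- Shift both indices by `m`, then use closure to replace degree m + i by k + i with k < m.
      -- The difference j + m - (k + i) exceeds j - i, so the previous `t` applies.
      rw [← hshift m i j hi, add_comm i m]
      refine (subsingleton_ext_resolutionImage_iff P _ m i hi).2 ?_
      refine subsingleton_ext_left_of_linearEquiv (X := ModuleCat.of R (⨁ l, W l)) e.symm _ i ?_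
      refine subsingleton_ext_directSum W i hi _ fun l => ?_
      obtain ⟨k, hk, hsum⟩ := hW l
      refine hsum.subsingleton_ext _ i ?_
      exact (subsingleton_ext_resolutionImage_iff P _ k i hi).1
        (ih (k + i) (j + m) (by lia) (by lia))
  exact
    { tor_eq_zero := fun i hi => (isZero_bimoduleTor_iff R S C N i hi).2 (hN i hi)
      ext_eq_zero := fun i hi => hV (i + 2) i 0 hi (by lia)
      valuation_bijective :=
        ⟨hC.valuation_injective_of_surjective (h 0) (hZ 0)
          (hC.valuation_surjective_of_ext_one (h 1) (hZ 1) (hV 3 1 2 le_rfl (by lia))),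
        hC.valuation_surjective_of_ext_one (h 0) (hZ 0) (hV 3 1 1 le_rfl (by lia))⟩ }

end Valuation

/-! ### Finite resolutions by modules in a class. -/

section RelativeDimension

variable {A : Type u} [Ring A] {𝒳 : ModuleCat.{u} A → Prop}

theorem hasResolutionOfLength_zero {N : ModuleCat.{u} A} (hN : 𝒳 N) :
    HasResolutionOfLength 𝒳 N 0 := by
  refine ⟨fun i => Nat.casesOn i N fun _ => ModuleCat.of A PUnit, fun i => 0, LinearMap.id,
    ?_, ?_, Function.surjective_id, ?_, ?_⟩
  · intro i hi
    obtain rfl : i = 0 := by lia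
    exact hN
  · intro i hi
    obtain ⟨i, rfl⟩ := Nat.exists_eq_add_of_le' hi
    exact inferInstanceAs (Subsingleton PUnit)
  · intro x
    exact ⟨fun hx => ⟨0, (show x = 0 from hx).symm⟩, fun ⟨_, hx⟩ => hx.symm⟩
  · intro i x
    exact ⟨fun _ => ⟨0, Subsingleton.elim (α := PUnit) _ _⟩, fun _ => rfl⟩

/-- Resolutions of a syzygy can be prolonged. -/
theorem HasResolutionOfLength.succ {K P N : ModuleCat.{u} A} {f : K →ₗ[A] P} {g : P →ₗ[A] N}
    (h : IsShortExact f g) (hP : 𝒳 P) {n : ℕ} (hK : HasResolutionOfLength 𝒳 K n) :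
    HasResolutionOfLength 𝒳 N (n + 1) := by
  obtain ⟨X, d, ε, hX, h0, hε, hdε, hd⟩ := hK
  refine ⟨fun i => Nat.casesOn i P X, fun i => match i with
    | 0 => f ∘ₗ ε
    | i + 1 => d i, g, ?_, ?_, h.surjective, ?_, ?_⟩
  · rintro (_ | i) hi
    · exact hP
    · exact hX i (by lia)
  · rintro (_ | i) hi
    · lia
    · exact h0 i (by lia)
  · intro x
    refine (h.exact x).trans ⟨?_, ?_⟩
    · rintro ⟨k, rfl⟩
      obtain ⟨y, rfl⟩ := hε k
      exact ⟨y, rfl⟩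
    · rintro ⟨y, rfl⟩
      exact ⟨ε y, rfl⟩
  · rintro (_ | i)
    · intro x
      refine Iff.trans ?_ (hdε x)
      exact map_eq_zero_iff f h.injective
    · exact hd i

theorem HasResolutionOfLength.exists_of_zero {N : ModuleCat.{u} A}
    (h : HasResolutionOfLength 𝒳 N 0) : ∃ X : ModuleCat.{u} A, 𝒳 X ∧ Nonempty (X ≃ₗ[A] N) := by
  obtain ⟨X, d, ε, hX, h0, hε, hdε, hd⟩ := h
  refine ⟨X 0, hX 0 le_rfl, ⟨LinearEquiv.ofBijective ε ⟨?_, hε⟩⟩⟩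
  rw [injective_iff_map_eq_zero]
  intro x hx
  obtain ⟨y, rfl⟩ := (hdε x).1 hx
  have := h0 1 zero_lt_one
  rw [Subsingleton.elim y 0, map_zero]

theorem HasResolutionOfLength.exists_of_succ {N : ModuleCat.{u} A} {n : ℕ}
    (h : HasResolutionOfLength 𝒳 N (n + 1)) :
    ∃ (K X : ModuleCat.{u} A) (f : K →ₗ[A] X) (g : X →ₗ[A] N),
      IsShortExact f g ∧ 𝒳 X ∧ HasResolutionOfLength 𝒳 K n := by
  obtain ⟨X, d, ε, hX, h0, hε, hdε, hd⟩ := h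
  refine ⟨ModuleCat.of A (LinearMap.ker ε), X 0, Submodule.subtype _, ε,
    ⟨Subtype.val_injective, LinearMap.exact_subtype_ker_map ε, hε⟩, hX 0 (by lia),
    fun i => X (i + 1), fun i => d (i + 1),
    (d 0).codRestrict (LinearMap.ker ε) fun x => hdε.apply_apply_eq_zero x,
    fun i hi => hX _ (by lia), fun i hi => h0 _ (by lia), ?_, ?_, fun i => hd (i + 1)⟩
  · rintro ⟨x, hx⟩
    obtain ⟨y, rfl⟩ := (hdε x).1 hx
    exact ⟨y, rfl⟩
  · exact fun x => Subtype.ext_iff.trans (hd 0 x)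

/-- If `Ext^i(X, D) = 0` for all `i ≥ 1` and all `X` in the class, then `Ext^i(N, D) = 0` for `i`
greater than the length of a resolution of `N`. -/
theorem HasResolutionOfLength.subsingleton_ext (D : ModuleCat.{u} A)
    (hD : ∀ X, 𝒳 X → ∀ i, 1 ≤ i → Subsingleton (Ext X D i)) {n : ℕ} :
    ∀ {N : ModuleCat.{u} A}, HasResolutionOfLength 𝒳 N n → ∀ i, n < i →
      Subsingleton (Ext N D i) := by
  induction n with
  | zero =>
    intro N h i hi
    obtain ⟨X, hX, ⟨e⟩⟩ := h.exists_of_zero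
    exact subsingleton_ext_left_of_linearEquiv e D i (hD X hX i hi)
  | succ n ih =>
    intro N h i hi
    obtain ⟨K, X, f, g, hfg, hX, hK⟩ := h.exists_of_succ
    obtain ⟨i, rfl⟩ := Nat.exists_eq_add_of_le' (show 1 ≤ i by lia)
    exact (hfg.ext_left_iff D i (hD X hX i (by lia)) (hD X hX (i + 1) (by lia))).2
      (ih hK i (by lia))

theorem relativeProjectiveDimension_le_iff {N : ModuleCat.{u} A} {n : ℕ} :
    relativeProjectiveDimension 𝒳 N ≤ (n : ℕ∞) ↔ ∃ m ≤ n, HasResolutionOfLength 𝒳 N m := by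
  constructor
  · intro h
    -- The strict bound by n + 1 makes the infimum yield an actual resolution.
    have hlt : relativeProjectiveDimension 𝒳 N < ((n + 1 : ℕ) : ℕ∞) :=
      lt_of_le_of_lt h (by exact_mod_cast Nat.lt_succ_self n)
    obtain ⟨_, ⟨m, rfl, hm⟩, hmn⟩ := sInf_lt_iff.1 hlt
    exact ⟨m, Nat.lt_succ_iff.1 (by exact_mod_cast hmn), hm⟩
  · rintro ⟨m, hmn, hm⟩
    have hmem : (m : ℕ∞) ∈ {k : ℕ∞ | ∃ n : ℕ, k = n ∧ HasResolutionOfLength 𝒳 N n} := ⟨m, rfl, hm⟩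
    exact (sInf_le hmem).trans (Nat.cast_le.2 hmn)

end RelativeDimension

/-- Projectives fill the first n places; the n-th syzygy is Tor-acyclic and so lies in the class. -/
theorem IsSemidualizing.hasResolutionOfLength_auslanderClass {R S : Type u} [Ring R] [Ring S]
    {C : Type u} [AddCommGroup C] [Module R C] [Module Sᵐᵒᵖ C] [SMulCommClass R Sᵐᵒᵖ C]
    (hC : IsSemidualizing R S C) (hclosed : HasUltimatelyClosedResolution (ModuleCat.of R C))
    (n : ℕ) : ∀ N : ModuleCat.{u} S,
      (∀ i, n < i → Subsingleton (Ext N (ModuleCat.of S (CharacterDual S C)) i)) →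
        HasResolutionOfLength (auslanderClass R S C) N n := by
  induction n with
  | zero =>
    intro N hN
    exact hasResolutionOfLength_zero (hC.auslanderClass_of_ext_characterDual hclosed N hN)
  | succ n ih =>
    intro N hN
    obtain ⟨K, P, f, g, _, h⟩ := exists_isShortExact_projective N
    refine .succ h (hC.auslanderClass_of_projective P) (ih K fun i hi => ?_)
    rw [← h.ext_left_iff _ i (subsingleton_ext_of_projective _ _ _ (by lia))
      (subsingleton_ext_of_projective _ _ _ (by lia))]
    exact hN _ (by lia)

end SemidualizingBimodule

theorem corollary4p11 (R S : Type u) [Ring R] [Ring S] (C : Type u) [AddCommGroup C]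
    [Module R C] [Module Sᵐᵒᵖ C] [SMulCommClass R Sᵐᵒᵖ C]
    (hC : SemidualizingBimodule.IsSemidualizing R S C)
    (hclosed : SemidualizingBimodule.HasUltimatelyClosedResolution (ModuleCat.of R C)) (n : ℕ) :
    projectiveDimension (ModuleCat.of Sᵐᵒᵖ C) ≤ (n : WithBot ℕ∞) ↔
      ∀ N : ModuleCat.{u} S,
        SemidualizingBimodule.auslanderProjectiveDimension R S C N ≤ (n : ℕ∞) := by
  obtain ⟨P, hP⟩ := hC.finite_right
  have hdual (m : ℕ) := SemidualizingBimodule.forall_subsingleton_ext_characterDual_iff P hP m 0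
  rw [projectiveDimension_le_iff]
  constructor
  · intro hpd N
    refine SemidualizingBimodule.relativeProjectiveDimension_le_iff.2
      ⟨n, le_rfl, hC.hasResolutionOfLength_auslanderClass hclosed n N fun i hi => ?_⟩
    obtain ⟨i, rfl⟩ := Nat.exists_eq_add_of_le' (show 1 ≤ i by lia)
    exact (hdual i).2 (hasProjectiveDimensionLT_of_ge (ModuleCat.of Sᵐᵒᵖ C) (n + 1) (i + 1)
      (by lia)) N
  · intro h
    -- Degree n + 1 alone suffices in this direction, and it exceeds the length m ≤ n of the
    -- resolution.
    refine (hdual n).1 fun N => ?_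
    obtain ⟨m, hmn, hm⟩ := SemidualizingBimodule.relativeProjectiveDimension_le_iff.1 (h N)
    exact hm.subsingleton_ext _ (fun X hX i hi =>
      (SemidualizingBimodule.isZero_bimoduleTor_iff R S C X i hi).1 (hX.tor_eq_zero i hi)) _
      (by lia)
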